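/- Let $I=[c,d)$ with $c<d$ be a bounded interval, let $D(J)$ denote the family of all dyadic subintervals of an interval $J$ (including $J$ itself), and let $\langle\varphi\rangle_J=\frac1{|J|}\int_J\varphi(t)\,dt$. Let $0\le m\le M$ and $$\Omega=\{x=(x_1,x_2,x_3)\in\mathbb R^3:\ x_1^2\le x_2,\ m\le x_3\le M\}.$$ For $x\in\Omega$ define the lower Carleson Bellman function by $$\mathbf B_{\min}(x;m,M)=\inf\ \frac1{|I|}\Big(\int_I|\varphi|^2\,d\mu+\sum_{J\in D(I)}|\langle\varphi\rangle_J|^2\,\alpha_J\Big),$$ where the infimum is taken over all real-valued $\varphi\in L^2(I)$, all non-negative atomless Borel measures $\mu$ on $I$ and all families of numbers $\alpha_J\ge0$ $(J\in D(I))$ such that $$\langle\varphi\rangle_I=x_1,\qquad \langle\varphi^2\rangle_I=x_2,\qquad \frac1{|I|}\Big(\mu(I)+\sum_{J\in D(I)}\alpha_J\Big)=x_3,$$ $$m|J|\le\mu(J)+\sum_{\ell\in D(J)}\alpha_\ell\le M|J|\qquad\text{for all }J\in D(I).$$ Let $x\in\Omega$. (i) Suppose $x_2>0$ and $M-(M-m)\frac{x_1^2}{x_2}<x_3\le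 M$. Then the equation $$\frac{x_1^2}{x_2}=\left[\frac{1-2a(M-x_3)}{1-2a(M-m)}\right]^2\frac{1-4a(M-m)}{1-4a(M-x_3)}$$ has exactly one solution $a=a^-(x)$ in $(-\infty,0]$; it is negative if $x_1^2<x_2$ and equals $0$ if $x_1^2=x_2$. With this $a$, $$\mathbf B_{\min}(x;m,M)=\frac{(x_3-m)\,x_2}{[1-2a(M-m)]^2\,[1-4a(M-x_3)]}+m\,x_2 .$$ (ii) Suppose $x_2>0$ and $m\le x_3\le M-(M-m)\frac{x_1^2}{x_2}$. Then $\mathbf B_{\min}(x;m,M)=m\,x_2$. (iii) If $x_2=0$ (hence $x_1=0$), then $\mathbf B_{\min}(x;m,M)=0$. -/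

import Mathlib

open MeasureTheory
open scoped NNReal ENNReal

noncomputable section

namespace CarlesonBellman

/-- Indices of the dyadic subintervals of a fixed interval: the pair `⟨n, k⟩` stands for
the `k`-th of the `2 ^ n` intervals of generation `n` (the interval itself is `⟨0, 0⟩`). -/
abbrev Dyadic : Type := Σ n : ℕ, Fin (2 ^ n)

/-- The dyadic subinterval of `[c, d)` with index `J`. Endpoints play no role, since
neither Lebesgue measure nor the measures considered below have atoms. -/
def interval (c d : ℝ) (J : Dyadic) : Set ℝ :=
  Set.Ico (c + (J.2 : ℕ) * ((d - c) / 2 ^ J.1)) (c + ((J.2 : ℕ) + 1) * ((d - c) / 2 ^ J.1))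

/-- The average of `f` over `J` with respect to Lebesgue measure. -/
def avg (c d : ℝ) (f : ℝ → ℝ) (J : Dyadic) : ℝ :=
  ⨍ t in interval c d J, f t

/-- The total mass `μ(J) + ∑_{ℓ ∈ D(J)} α_ℓ` carried by the dyadic interval `J`, where `D(J)`
is the family of all dyadic subintervals of `J` (including `J` itself). -/
def mass (c d : ℝ) (μ : Measure ℝ) (α : Dyadic → ℝ≥0) (J : Dyadic) : ℝ≥0∞ :=
  μ (interval c d J) + ∑' l : {l : Dyadic // interval c d l ⊆ interval c d J}, (α l : ℝ≥0∞)

/-- The test function `φ`, the non-negative atomless measure `μ` and the non-negative numbers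
`α_J` compete in the extremal problem at `(x₁, x₂, x₃)` on the interval `I = [c, d)`. Only the
restrictions of `φ` and `μ` to `I` matter. -/
structure Admissible (c d m M x₁ x₂ x₃ : ℝ) (φ : ℝ → ℝ) (μ : Measure ℝ)
    (α : Dyadic → ℝ≥0) : Prop where
  memLp : MemLp φ 2 (volume.restrict (Set.Ico c d))
  noAtoms : ∀ t : ℝ, μ {t} = 0
  avg_eq : ⨍ t in Set.Ico c d, φ t = x₁
  avg_sq_eq : ⨍ t in Set.Ico c d, φ t ^ 2 = x₂
  mass_eq : (μ (Set.Ico c d) + ∑' J, (α J : ℝ≥0∞)) / volume (Set.Ico c d) = ENNReal.ofReal x₃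
  le_mass : ∀ J, ENNReal.ofReal m * volume (interval c d J) ≤ mass c d μ α J
  mass_le : ∀ J, mass c d μ α J ≤ ENNReal.ofReal M * volume (interval c d J)

/-- The quantity `|I|⁻¹ (∫_I φ² dμ + ∑_{J ∈ D(I)} ⟨φ⟩_J² α_J)` to be minimized. -/
def functional (c d : ℝ) (φ : ℝ → ℝ) (μ : Measure ℝ) (α : Dyadic → ℝ≥0) : ℝ≥0∞ :=
  (∫⁻ t in Set.Ico c d, ENNReal.ofReal (φ t ^ 2) ∂μ +
    ∑' J, ENNReal.ofReal (avg c d φ J ^ 2) * (α J : ℝ≥0∞)) / volume (Set.Ico c d)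

/-- The lower Bellman function of the dyadic Carleson embedding theorem on `I = [c, d)`. The
infimum is taken in `[0, ∞]`; it would be `∞` if there were no competitors. -/
def Bmin (c d m M x₁ x₂ x₃ : ℝ) : ℝ≥0∞ :=
  ⨅ (φ : ℝ → ℝ) (μ : Measure ℝ) (α : Dyadic → ℝ≥0) (_ : Admissible c d m M x₁ x₂ x₃ φ μ α),
    functional c d φ μ α

/-- The cubic equation for `a`. -/
def Cubic (m M x₁ x₂ x₃ a : ℝ) : Prop :=
  x₁ ^ 2 / x₂ = ((1 - 2 * a * (M - x₃)) / (1 - 2 * a * (M - m))) ^ 2 *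
    ((1 - 4 * a * (M - m)) / (1 - 4 * a * (M - x₃)))

/-- The candidate `B(x₁, x₂, x₃; m, M)`, as a function of the root `a` of the cubic. -/
def B (m M x₂ x₃ a : ℝ) : ℝ :=
  (x₃ - m) * x₂ / ((1 - 2 * a * (M - m)) ^ 2 * (1 - 4 * a * (M - x₃))) + m * x₂

end CarlesonBellman

end

/-! Two matching bounds are proved. Throughout, put `s = -2a`, `z = M - x₃`, `L = M - m`.

Lower bound. If `G` satisfies `MainInequality` and `G ≤ x₂ x₃` on the domain, then `G ≤ Bmin`:
halving the interval `n` times and applying the inequality at each node bounds `|I| G` by the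
Carleson sum plus the contributions of the leaves, and on a short leaf `x₂ x₃ |J|` is close to `∫_J
φ² dμ` (`minorant_le_of_uniform`, `minorant_mul_length_le`). The last point needs `μ ≤ M · Lebesgue`
on `I` (`restrict_Ico_le_smul_volume`), which makes approximation of `φ²` in `L¹` by continuous
functions effective for `μ` too. The functions `minorant m M s`, `s > 0`, qualify, because `(p, A) ↦
p² / A` is convex. For fixed `x` the critical equation in `s` is exactly the cubic, and the value at
its root is `B`. The function `m x₂` covers the flat region.

Upper bound. Competitors built by finitely many halvings are described by `Reach`. The infimum
`reachInf` of their values is convex along segments of the domain, homogeneous under `φ ↦ kφ`, and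
rises by at most `a x₁²` when mass `a` is placed at the top. On the face `x₃ = M`, split off a small
portion `ε` of density `m`, with `φ` constant there, leave a rescaled copy of the original point on
the rest, and restore the lost mass at the top. This bounds the value at the point by itself with a
factor; solving and letting `ε → 0` gives `reachInf_top`. Segments from that face to the edge `x₁² =
x₂`, `x₃ = m` then reach every point of the non-flat region (`reachInf_extremal`). In the flat
region the upper endpoint has `x₁ = 0`, where adding mass at the top is free
(`reachInf_le_of_flat`). -/

namespace CarlesonBellman

/-! ### Self-similarity of the dyadic tree -/

/-- The interval itself, as a dyadic index. -/
def root : Dyadic := ⟨0, ⟨0, by norm_num⟩⟩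

/-- The index in `[c, d)` of a dyadic subinterval of the left half. -/
def leftHalf (J : Dyadic) : Dyadic :=
  ⟨J.1 + 1, ⟨J.2, by have := J.2.2; rw [pow_succ]; omega⟩⟩

/-- The index in `[c, d)` of a dyadic subinterval of the right half. -/
def rightHalf (J : Dyadic) : Dyadic :=
  ⟨J.1 + 1, ⟨2 ^ J.1 + J.2, by have := J.2.2; rw [pow_succ]; omega⟩⟩

lemma eq_root_or_half (J : Dyadic) :
    J = root ∨ (∃ K, J = leftHalf K) ∨ ∃ K, J = rightHalf K := by
  obtain ⟨n, k, hk⟩ := J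
  cases n with
  | zero => left; simp at hk; subst hk; rfl
  | succ n =>
    right
    by_cases h : k < 2 ^ n
    · exact Or.inl ⟨⟨n, k, h⟩, rfl⟩
    · refine Or.inr ⟨⟨n, k - 2 ^ n, by rw [pow_succ] at hk; omega⟩, ?_⟩
      simp only [rightHalf, Sigma.mk.injEq, heq_eq_eq, Fin.mk.injEq, true_and]
      omega

lemma tsum_dyadic (f : Dyadic → ℝ≥0∞) :
    ∑' J, f J = f root + (∑' J, f (leftHalf J) + ∑' J, f (rightHalf J)) := by
  rw [ENNReal.tsum_sigma' f, ENNReal.tsum_sigma' (fun J => f (leftHalf J)),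
    ENNReal.tsum_sigma' (fun J => f (rightHalf J)), ← ENNReal.tsum_add,
    tsum_eq_zero_add' ENNReal.summable]
  congr 1
  · rw [tsum_fintype]
    exact Fin.sum_univ_one (fun k : Fin 1 => f ⟨0, k⟩)
  · refine tsum_congr fun n => ?_
    simp only [tsum_fintype]
    have e : 2 ^ n + 2 ^ n = 2 ^ (n + 1) := by ring
    rw [← Equiv.sum_comp (finCongr e), Fin.sum_univ_add]
    rfl

lemma interval_root (c d : ℝ) : interval c d root = Set.Ico c d := by
  simp [interval, root]

lemma interval_leftHalf (c d : ℝ) (J : Dyadic) :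
    interval c d (leftHalf J) = interval c ((c + d) / 2) J := by
  have h : (d - c) / 2 ^ (J.1 + 1) = ((c + d) / 2 - c) / 2 ^ J.1 := by
    rw [pow_succ]; field_simp; ring
  simp only [interval, leftHalf, h]

lemma interval_rightHalf (c d : ℝ) (J : Dyadic) :
    interval c d (rightHalf J) = interval ((c + d) / 2) d J := by
  have h : (d - c) / 2 ^ (J.1 + 1) = (d - (c + d) / 2) / 2 ^ J.1 := by
    rw [pow_succ]; field_simp; ring
  simp only [interval, rightHalf, h]
  push_cast
  congr 1 <;> field_simp <;> ring

lemma volume_interval (c d : ℝ) (J : Dyadic) :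
    volume (interval c d J) = ENNReal.ofReal ((d - c) / 2 ^ J.1) := by
  rw [interval, Real.volume_Ico]
  congr 1; ring

lemma left_mem_interval {c d : ℝ} (hcd : c < d) (J : Dyadic) :
    c + (J.2 : ℕ) * ((d - c) / 2 ^ J.1) ∈ interval c d J := by
  have : 0 < (d - c) / 2 ^ J.1 := div_pos (sub_pos.2 hcd) (by positivity)
  refine ⟨le_rfl, ?_⟩
  nlinarith

lemma interval_subset {c d : ℝ} (hcd : c ≤ d) (J : Dyadic) : interval c d J ⊆ Set.Ico c d := by
  have h0 : 0 ≤ (d - c) / 2 ^ J.1 := div_nonneg (sub_nonneg.2 hcd) (by positivity)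
  have h1 : ((J.2 : ℕ) : ℝ) + 1 ≤ 2 ^ J.1 := by exact_mod_cast J.2.2
  have h2 : (2 ^ J.1 : ℝ) * ((d - c) / 2 ^ J.1) = d - c := by field_simp
  refine Set.Ico_subset_Ico ?_ ?_
  · have := mul_nonneg (Nat.cast_nonneg (α := ℝ) (J.2 : ℕ)) h0
    linarith
  · have := mul_le_mul_of_nonneg_right h1 h0
    linarith

lemma measurableSet_interval (c d : ℝ) (J : Dyadic) : MeasurableSet (interval c d J) :=
  measurableSet_Ico

lemma Ico_union_half {c d : ℝ} (hcd : c < d) :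
    Set.Ico c ((c + d) / 2) ∪ Set.Ico ((c + d) / 2) d = Set.Ico c d :=
  Set.Ico_union_Ico_eq_Ico (by linarith) (by linarith)

lemma disjoint_half (c d : ℝ) :
    Disjoint (Set.Ico c ((c + d) / 2)) (Set.Ico ((c + d) / 2) d) := by
  rw [Set.disjoint_left]
  intro x hx hy
  exact absurd hx.2 (not_lt.2 hy.1)

/-- With the index type independent of `J`, the sum can be split by `tsum_dyadic`. -/
lemma mass_eq_tsum_indicator (c d : ℝ) (μ : Measure ℝ) (α : Dyadic → ℝ≥0) (J : Dyadic) :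
    mass c d μ α J = μ (interval c d J) +
      ∑' l, Set.indicator {l | interval c d l ⊆ interval c d J} (fun l => (α l : ℝ≥0∞)) l := by
  rw [← tsum_subtype]; rfl

lemma mass_root {c d : ℝ} (hcd : c ≤ d) (μ : Measure ℝ) (α : Dyadic → ℝ≥0) :
    mass c d μ α root = μ (Set.Ico c d) + ∑' J, (α J : ℝ≥0∞) := by
  rw [mass_eq_tsum_indicator, interval_root]
  congr 1
  refine tsum_congr fun l => ?_
  rw [Set.indicator_of_mem (interval_subset hcd l)]

lemma not_root_subset_left {c d : ℝ} (hcd : c < d) (J : Dyadic) :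
    ¬ interval c d root ⊆ interval c d (leftHalf J) := by
  intro h
  rw [interval_root, interval_leftHalf] at h
  have h1 : (c + d) / 2 ∈ Set.Ico c d := ⟨by linarith, by linarith⟩
  exact lt_irrefl _ (interval_subset (by linarith) J (h h1)).2

lemma not_root_subset_right {c d : ℝ} (hcd : c < d) (J : Dyadic) :
    ¬ interval c d root ⊆ interval c d (rightHalf J) := by
  intro h
  rw [interval_root, interval_rightHalf] at h
  have h1 : c ∈ Set.Ico c d := ⟨by linarith, by linarith⟩
  have := (interval_subset (by linarith) J (h h1)).1
  linarith

lemma not_right_subset_left {c d : ℝ} (hcd : c < d) (J K : Dyadic) :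
    ¬ interval c d (rightHalf K) ⊆ interval c d (leftHalf J) := by
  intro h
  rw [interval_rightHalf, interval_leftHalf] at h
  have h1 := left_mem_interval (c := (c + d) / 2) (d := d) (by linarith) K
  exact Set.disjoint_left.1 (disjoint_half c d) (interval_subset (by linarith) _ (h h1))
    (interval_subset (by linarith) _ h1)

lemma not_left_subset_right {c d : ℝ} (hcd : c < d) (J K : Dyadic) :
    ¬ interval c d (leftHalf K) ⊆ interval c d (rightHalf J) := by
  intro h
  rw [interval_rightHalf, interval_leftHalf] at h
  have h1 := left_mem_interval (c := c) (d := (c + d) / 2) (by linarith) K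
  exact Set.disjoint_left.1 (disjoint_half c d) (interval_subset (by linarith) _ h1)
    (interval_subset (by linarith) _ (h h1))

-- Neither the root nor any interval of the right half lies inside the left half, so only the
-- left-hand coefficients survive.
open Classical in
lemma mass_leftHalf {c d : ℝ} (hcd : c < d) (μ : Measure ℝ) (α : Dyadic → ℝ≥0) (J : Dyadic) :
    mass c d μ α (leftHalf J) = mass c ((c + d) / 2) μ (α ∘ leftHalf) J := by
  rw [mass_eq_tsum_indicator, mass_eq_tsum_indicator, tsum_dyadic,
    Set.indicator_of_notMem (not_root_subset_left hcd J)]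
  simp only [Set.indicator_apply, Set.mem_ofPred_eq, not_right_subset_left hcd, if_false, tsum_zero,
    zero_add, add_zero]
  simp only [interval_leftHalf, Function.comp]

open Classical in
lemma mass_rightHalf {c d : ℝ} (hcd : c < d) (μ : Measure ℝ) (α : Dyadic → ℝ≥0) (J : Dyadic) :
    mass c d μ α (rightHalf J) = mass ((c + d) / 2) d μ (α ∘ rightHalf) J := by
  rw [mass_eq_tsum_indicator, mass_eq_tsum_indicator, tsum_dyadic,
    Set.indicator_of_notMem (not_root_subset_right hcd J)]
  simp only [Set.indicator_apply, Set.mem_ofPred_eq, not_left_subset_right hcd, if_false, tsum_zero,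
    zero_add]
  simp only [interval_rightHalf, Function.comp]

lemma measure_Ico_half {c d : ℝ} (hcd : c < d) (μ : Measure ℝ) :
    μ (Set.Ico c d) = μ (Set.Ico c ((c + d) / 2)) + μ (Set.Ico ((c + d) / 2) d) := by
  rw [← Ico_union_half hcd, measure_union (disjoint_half c d) measurableSet_Ico]

lemma mass_root_eq_add {c d : ℝ} (hcd : c < d) (μ : Measure ℝ) (α : Dyadic → ℝ≥0) :
    mass c d μ α root = α root + (mass c ((c + d) / 2) μ (α ∘ leftHalf) root +
      mass ((c + d) / 2) d μ (α ∘ rightHalf) root) := by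
  rw [mass_root hcd.le, mass_root (by linarith), mass_root (by linarith), tsum_dyadic,
    measure_Ico_half hcd]
  simp only [Function.comp]
  ring

lemma avg_leftHalf (c d : ℝ) (f : ℝ → ℝ) (J : Dyadic) :
    avg c d f (leftHalf J) = avg c ((c + d) / 2) f J := by
  rw [avg, avg, interval_leftHalf]

lemma avg_rightHalf (c d : ℝ) (f : ℝ → ℝ) (J : Dyadic) :
    avg c d f (rightHalf J) = avg ((c + d) / 2) d f J := by
  rw [avg, avg, interval_rightHalf]

lemma avg_root (c d : ℝ) (f : ℝ → ℝ) : avg c d f root = ⨍ t in Set.Ico c d, f t := by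
  rw [avg, interval_root]

lemma average_Ico {c d : ℝ} (hcd : c ≤ d) (f : ℝ → ℝ) :
    ⨍ t in Set.Ico c d, f t = (∫ t in Set.Ico c d, f t) / (d - c) := by
  rw [setAverage_eq, Real.volume_real_Ico_of_le hcd, smul_eq_mul, div_eq_inv_mul]

lemma setIntegral_half {c d : ℝ} (hcd : c < d) {ν : Measure ℝ} {f : ℝ → ℝ}
    (hf : IntegrableOn f (Set.Ico c d) ν) :
    ∫ t in Set.Ico c d, f t ∂ν =
      ∫ t in Set.Ico c ((c + d) / 2), f t ∂ν + ∫ t in Set.Ico ((c + d) / 2) d, f t ∂ν := by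
  rw [← Ico_union_half hcd] at hf ⊢
  exact setIntegral_union (disjoint_half c d) measurableSet_Ico
    (hf.mono_set Set.subset_union_left) (hf.mono_set Set.subset_union_right)

lemma average_half {c d : ℝ} (hcd : c < d) {f : ℝ → ℝ} (hf : IntegrableOn f (Set.Ico c d)) :
    ⨍ t in Set.Ico c d, f t =
      ((⨍ t in Set.Ico c ((c + d) / 2), f t) + ⨍ t in Set.Ico ((c + d) / 2) d, f t) / 2 := by
  rw [average_Ico hcd.le, average_Ico (by linarith), average_Ico (by linarith),
    setIntegral_half hcd hf]
  have h : d - c ≠ 0 := by linarith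
  have h1 : (c + d) / 2 - c = (d - c) / 2 := by ring
  have h2 : d - (c + d) / 2 = (d - c) / 2 := by ring
  rw [h1, h2]
  field_simp

/-! ### From dyadic intervals to all Borel sets -/

lemma exists_child {c d : ℝ} {n : ℕ} {k : Fin (2 ^ n)} {t : ℝ}
    (ht : t ∈ interval c d ⟨n, k⟩) :
    ∃ k', t ∈ interval c d ⟨n + 1, k'⟩ ∧ interval c d ⟨n + 1, k'⟩ ⊆ interval c d ⟨n, k⟩ := by
  obtain ⟨h1, h2⟩ := ht
  simp only at h1 h2
  have hk := k.2
  have e : (d - c) / 2 ^ n = 2 * ((d - c) / 2 ^ (n + 1)) := by rw [pow_succ]; field_simp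
  rw [e] at h1 h2
  generalize hh : (d - c) / 2 ^ (n + 1) = h at h1 h2 e
  have h0 : 0 < h := by linarith
  rcases lt_or_ge t (c + (2 * (k : ℕ) + 1) * h) with ht | ht
  · refine ⟨⟨2 * k, by rw [pow_succ]; omega⟩, ?_, ?_⟩
    · simp only [interval, hh, Set.mem_Ico]
      push_cast
      constructor <;> linarith
    · simp only [interval, hh, e]
      push_cast
      exact Set.Ico_subset_Ico (by linarith) (by linarith)
  · refine ⟨⟨2 * k + 1, by rw [pow_succ]; omega⟩, ?_, ?_⟩
    · simp only [interval, hh, Set.mem_Ico]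
      push_cast
      constructor <;> linarith
    · simp only [interval, hh, e]
      push_cast
      exact Set.Ico_subset_Ico (by linarith) (by linarith)

lemma exists_mem_interval {c d t : ℝ} (ht : t ∈ Set.Ico c d) (n : ℕ) :
    ∃ k, t ∈ interval c d ⟨n, k⟩ := by
  induction n with
  | zero => exact ⟨root.2, by rw [← interval_root] at ht; exact ht⟩
  | succ n ih =>
    obtain ⟨k, hk⟩ := ih
    obtain ⟨k', hk', -⟩ := exists_child hk
    exact ⟨k', hk'⟩

lemma pairwise_disjoint_interval {c d : ℝ} (hcd : c ≤ d) (n : ℕ) :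
    Pairwise fun j k : Fin (2 ^ n) => Disjoint (interval c d ⟨n, j⟩) (interval c d ⟨n, k⟩) := by
  have h0 : 0 ≤ (d - c) / 2 ^ n := div_nonneg (sub_nonneg.2 hcd) (by positivity)
  have key : ∀ j k : Fin (2 ^ n), j < k →
      Disjoint (interval c d ⟨n, j⟩) (interval c d ⟨n, k⟩) := by
    intro j k hjk
    rw [Set.disjoint_left]
    rintro x ⟨-, hx⟩ ⟨hy, -⟩
    simp only at hx hy
    have : ((j : ℕ) : ℝ) + 1 ≤ (k : ℕ) := by exact_mod_cast hjk
    have := mul_le_mul_of_nonneg_right this h0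
    linarith
  intro j k hjk
  rcases lt_or_gt_of_ne hjk with h | h
  · exact key j k h
  · exact (key k j h).symm

-- Inside `[c, d)` an open set is exhausted by the increasing sets `V n`, each a finite disjoint
-- union of generation-`n` intervals, so the comparison passes to the limit by continuity from
-- below.
open Filter Topology in
lemma measure_inter_Ico_le_of_isOpen {c d : ℝ} (hcd : c ≤ d) {μ ν : Measure ℝ}
    (h : ∀ J, μ (interval c d J) ≤ ν (interval c d J)) {U : Set ℝ} (hU : IsOpen U) :
    μ (U ∩ Set.Ico c d) ≤ ν U := by
  classical
  let V : ℕ → Set ℝ := fun n =>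
    ⋃ k ∈ Finset.univ.filter (fun k => interval c d ⟨n, k⟩ ⊆ U), interval c d ⟨n, k⟩
  have hV : ∀ n t, t ∈ V n ↔ ∃ k, interval c d ⟨n, k⟩ ⊆ U ∧ t ∈ interval c d ⟨n, k⟩ := by
    intro n t
    simp [V]
  have hmono : Monotone V := by
    refine monotone_nat_of_le_succ fun n t ht => ?_
    obtain ⟨k, hk, htk⟩ := (hV n t).1 ht
    obtain ⟨k', h1, h2⟩ := exists_child htk
    exact (hV _ _).2 ⟨k', h2.trans hk, h1⟩
  have hsub : U ∩ Set.Ico c d ⊆ ⋃ n, V n := by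
    rintro t ⟨htU, ht⟩
    obtain ⟨ε, hε, hball⟩ := Metric.isOpen_iff.1 hU t htU
    have hlim : Tendsto (fun n : ℕ => (d - c) / 2 ^ n) atTop (𝓝 0) :=
      tendsto_const_nhds.div_atTop (tendsto_pow_atTop_atTop_of_one_lt one_lt_two)
    obtain ⟨n, hn⟩ := (hlim.eventually_lt_const hε).exists
    obtain ⟨k, hk⟩ := exists_mem_interval ht n
    refine Set.mem_iUnion.2 ⟨n, (hV _ _).2 ⟨k, fun s hs => hball ?_, hk⟩⟩
    obtain ⟨h1, h2⟩ := hk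
    obtain ⟨h3, h4⟩ := hs
    simp only at h1 h2 h3 h4
    rw [Metric.mem_ball, Real.dist_eq, abs_lt]
    constructor <;> linarith
  refine (measure_mono hsub).trans ?_
  rw [hmono.measure_iUnion]
  refine iSup_le fun n => ?_
  calc μ (V n) ≤ ∑ k ∈ Finset.univ.filter (fun k => interval c d ⟨n, k⟩ ⊆ U),
        μ (interval c d ⟨n, k⟩) := measure_biUnion_finset_le _ _
    _ ≤ ∑ k ∈ Finset.univ.filter (fun k => interval c d ⟨n, k⟩ ⊆ U),
        ν (interval c d ⟨n, k⟩) := Finset.sum_le_sum fun k _ => h _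
    _ = ν (V n) := by
        rw [measure_biUnion_finset]
        · exact fun j _ k _ hjk => pairwise_disjoint_interval hcd n hjk
        · exact fun k _ => measurableSet_interval _ _ _
    _ ≤ ν U := measure_mono fun t ht => by
        obtain ⟨k, hk, htk⟩ := (hV n t).1 ht
        exact hk htk

-- Open sets suffice because Lebesgue measure is outer regular; no regularity of `μ` is needed.
open Filter Topology in
lemma restrict_Ico_le_smul_volume {c d : ℝ} (hcd : c ≤ d) {μ : Measure ℝ} {K : ℝ≥0∞}
    (hK : K ≠ ∞) (h : ∀ J, μ (interval c d J) ≤ K * volume (interval c d J)) :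
    μ.restrict (Set.Ico c d) ≤ K • volume.restrict (Set.Ico c d) := by
  refine Measure.le_iff.2 fun s hs => ?_
  rw [Measure.restrict_apply hs, Measure.smul_apply, Measure.restrict_apply hs, smul_eq_mul]
  have hlim : Tendsto (fun ε : ℝ≥0∞ => K * (volume (s ∩ Set.Ico c d) + ε)) (𝓝[>] 0)
      (𝓝 (K * (volume (s ∩ Set.Ico c d) + 0))) :=
    (ENNReal.Tendsto.const_mul (tendsto_const_nhds.add tendsto_id) (Or.inr hK)).mono_left
      nhdsWithin_le_nhds
  rw [add_zero] at hlim
  refine ge_of_tendsto hlim ?_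
  filter_upwards [self_mem_nhdsWithin] with ε hε
  obtain ⟨U, hsU, hU, hle⟩ := Set.exists_isOpen_le_add (s ∩ Set.Ico c d) volume (ne_of_gt hε)
  calc μ (s ∩ Set.Ico c d) ≤ μ (U ∩ Set.Ico c d) :=
        measure_mono fun t ht => ⟨hsU ht, ht.2⟩
    _ ≤ (K • volume : Measure ℝ) U := measure_inter_Ico_le_of_isOpen hcd (by simpa using h) hU
    _ ≤ K * (volume (s ∩ Set.Ico c d) + ε) := by
        rw [Measure.smul_apply, smul_eq_mul]
        gcongr

/-! ### Tails, Carleson sums and mass bounds on halves -/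

/-- The total mass of the numbers `α J` over the generations from `n` on. -/
noncomputable def tail (n : ℕ) (α : Dyadic → ℝ≥0) : ℝ≥0∞ :=
  ∑' J : Dyadic, if n ≤ J.1 then (α J : ℝ≥0∞) else 0

lemma tail_zero (α : Dyadic → ℝ≥0) : tail 0 α = ∑' J, (α J : ℝ≥0∞) := by
  simp [tail]

lemma tail_succ (n : ℕ) (α : Dyadic → ℝ≥0) :
    tail (n + 1) α = tail n (α ∘ leftHalf) + tail n (α ∘ rightHalf) := by
  rw [tail, tsum_dyadic]
  simp [tail, root, leftHalf, rightHalf]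

lemma tail_le (n : ℕ) (α : Dyadic → ℝ≥0) : tail n α ≤ ∑' J, (α J : ℝ≥0∞) :=
  ENNReal.tsum_le_tsum fun J => by split_ifs <;> simp

open Filter Topology in
lemma tendsto_tail {α : Dyadic → ℝ≥0} (h : ∑' J, (α J : ℝ≥0∞) ≠ ∞) :
    Tendsto (fun n => tail n α) atTop (𝓝 0) := by
  have e : ∀ n, tail n α = ∑' i, ∑' k, (α ⟨i + n, k⟩ : ℝ≥0∞) := by
    intro n
    rw [tail, ENNReal.tsum_sigma' (fun J : Dyadic => if n ≤ J.1 then (α J : ℝ≥0∞) else 0),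
      ← ENNReal.summable.sum_add_tsum_nat_add' (k := n), Finset.sum_eq_zero, zero_add]
    · simp
    · intro i hi
      simp [Finset.mem_range.1 hi]
  simp_rw [e]
  rw [ENNReal.tsum_sigma'] at h
  exact ENNReal.tendsto_sum_nat_add (fun i => ∑' k, (α ⟨i, k⟩ : ℝ≥0∞)) h

/-- The sum `∑ ⟨φ⟩_J² α_J` over the dyadic subintervals of `[c, d)`. -/
noncomputable def carlesonSum (φ : ℝ → ℝ) (c d : ℝ) (α : Dyadic → ℝ≥0) : ℝ≥0∞ :=
  ∑' J, ENNReal.ofReal (avg c d φ J ^ 2) * (α J : ℝ≥0∞)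

lemma carlesonSum_eq (φ : ℝ → ℝ) (c d : ℝ) (α : Dyadic → ℝ≥0) :
    carlesonSum φ c d α = ENNReal.ofReal ((⨍ t in Set.Ico c d, φ t) ^ 2) * (α root : ℝ≥0∞) +
      (carlesonSum φ c ((c + d) / 2) (α ∘ leftHalf) +
        carlesonSum φ ((c + d) / 2) d (α ∘ rightHalf)) := by
  rw [carlesonSum, tsum_dyadic]
  simp only [avg_root, avg_leftHalf, avg_rightHalf, carlesonSum, Function.comp]

/-- Every dyadic subinterval `J` of `[c, d)` has mass between `m |J|` and `M |J|`. -/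
def MassBounds (m M c d : ℝ) (μ : Measure ℝ) (α : Dyadic → ℝ≥0) : Prop :=
  ∀ J, ENNReal.ofReal m * volume (interval c d J) ≤ mass c d μ α J ∧
    mass c d μ α J ≤ ENNReal.ofReal M * volume (interval c d J)

section
variable {m M c d : ℝ} {μ : Measure ℝ} {α : Dyadic → ℝ≥0}

lemma MassBounds.left (h : MassBounds m M c d μ α) (hcd : c < d) :
    MassBounds m M c ((c + d) / 2) μ (α ∘ leftHalf) := by
  intro J
  simpa only [mass_leftHalf hcd, interval_leftHalf] using h (leftHalf J)

lemma MassBounds.right (h : MassBounds m M c d μ α) (hcd : c < d) :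
    MassBounds m M ((c + d) / 2) d μ (α ∘ rightHalf) := by
  intro J
  simpa only [mass_rightHalf hcd, interval_rightHalf] using h (rightHalf J)

lemma MassBounds.mass_root_ne_top (h : MassBounds m M c d μ α) : mass c d μ α root ≠ ∞ := by
  refine ne_top_of_le_ne_top ?_ (h root).2
  rw [volume_interval]
  exact ENNReal.mul_ne_top ENNReal.ofReal_ne_top ENNReal.ofReal_ne_top

lemma MassBounds.measure_ne_top (h : MassBounds m M c d μ α) (hcd : c < d) :
    μ (Set.Ico c d) ≠ ∞ := by
  refine ne_top_of_le_ne_top h.mass_root_ne_top ?_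
  rw [mass_root hcd.le]
  exact le_self_add

lemma MassBounds.tsum_ne_top (h : MassBounds m M c d μ α) (hcd : c < d) :
    ∑' J, (α J : ℝ≥0∞) ≠ ∞ := by
  refine ne_top_of_le_ne_top h.mass_root_ne_top ?_
  rw [mass_root hcd.le]
  exact le_add_self

lemma MassBounds.toReal_mass_le (h : MassBounds m M c d μ α) (hcd : c < d) (hM : 0 ≤ M) :
    (mass c d μ α root).toReal ≤ M * (d - c) := by
  have h1 := (h root).2
  rw [interval_root, Real.volume_Ico, ← ENNReal.ofReal_mul hM] at h1
  have h0 : 0 ≤ M * (d - c) := mul_nonneg hM (by linarith)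
  simpa [ENNReal.toReal_ofReal h0] using ENNReal.toReal_mono ENNReal.ofReal_ne_top h1

lemma MassBounds.le_toReal_mass (h : MassBounds m M c d μ α) (hcd : c < d) (hm : 0 ≤ m) :
    m * (d - c) ≤ (mass c d μ α root).toReal := by
  have h1 := (h root).1
  rw [interval_root, Real.volume_Ico, ← ENNReal.ofReal_mul hm] at h1
  have h0 : 0 ≤ m * (d - c) := mul_nonneg hm (by linarith)
  simpa [ENNReal.toReal_ofReal h0] using ENNReal.toReal_mono h.mass_root_ne_top h1

lemma MassBounds.restrict_le (h : MassBounds m M c d μ α) (hcd : c < d) :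
    μ.restrict (Set.Ico c d) ≤ ENNReal.ofReal M • volume.restrict (Set.Ico c d) := by
  refine restrict_Ico_le_smul_volume hcd.le ENNReal.ofReal_ne_top fun J => le_trans ?_ (h J).2
  exact le_self_add

lemma MassBounds.integrableOn (h : MassBounds m M c d μ α) (hcd : c < d) {f : ℝ → ℝ}
    (hf : IntegrableOn f (Set.Ico c d)) : IntegrableOn f (Set.Ico c d) μ :=
  Integrable.of_measure_le_smul ENNReal.ofReal_ne_top (h.restrict_le hcd) hf

end

/-! ### Bellman induction: minorants lie below the Bellman function -/

/-- The main inequality for a minorant of the lower Bellman function. -/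
def MainInequality (m M : ℝ) (G : ℝ → ℝ → ℝ → ℝ) : Prop :=
  ∀ p₁ p₂ p₃ q₁ q₂ q₃ a : ℝ, m ≤ p₃ → p₃ ≤ M → m ≤ q₃ → q₃ ≤ M → 0 ≤ a →
    (p₃ + q₃) / 2 + a ≤ M →
    G ((p₁ + q₁) / 2) ((p₂ + q₂) / 2) ((p₃ + q₃) / 2 + a) ≤
      (G p₁ p₂ p₃ + G q₁ q₂ q₃) / 2 + a * ((p₁ + q₁) / 2) ^ 2

lemma sq_average_le {c d : ℝ} (hcd : c < d) {φ : ℝ → ℝ}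
    (hφ : MemLp φ 2 (volume.restrict (Set.Ico c d))) :
    (⨍ t in Set.Ico c d, φ t) ^ 2 ≤ ⨍ t in Set.Ico c d, φ t ^ 2 := by
  have h0 : volume (Set.Ico c d) ≠ 0 := by simp [hcd]
  have h1 : volume (Set.Ico c d) ≠ ∞ := by simp
  have hi : IntegrableOn φ (Set.Ico c d) := hφ.integrable one_le_two
  exact (even_two.convexOn_pow (𝕜 := ℝ)).set_average_mem_epigraph (by fun_prop) isClosed_univ h0 h1 (by simp) hi
    hφ.integrable_sq |>.2

/-- The induction halves the interval until the leaves have length at most `δ`. On a leaf, `G ≤ x₂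
x₃` leaves `⟨φ²⟩ (μ(J) + ∑ α)`. Replacing `⟨φ²⟩` by `⟨g⟩` costs the `M ∫ |φ² - g|` term, replacing
`⟨g⟩` by `g` under `μ` costs `ω μ(J)`, and the coefficients still lumped into the leaf cost `K`
times the tail. All three errors are additive over halves, so the inductive step is just
`MainInequality`. -/
lemma minorant_le_of_uniform {m M : ℝ} (hm : 0 ≤ m) (hmM : m ≤ M) {G : ℝ → ℝ → ℝ → ℝ}
    (hG : MainInequality m M G)
    (hG' : ∀ x₁ x₂ x₃, x₁ ^ 2 ≤ x₂ → m ≤ x₃ → x₃ ≤ M → G x₁ x₂ x₃ ≤ x₂ * x₃)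
    {φ g : ℝ → ℝ} {μ : Measure ℝ} {ω K δ : ℝ} (hg : Continuous g) (hK : ∀ t, g t ≤ K)
    (hω : ∀ s t, |s - t| ≤ δ → |g s - g t| ≤ ω) (n : ℕ) :
    ∀ (c d : ℝ) (α : Dyadic → ℝ≥0), c < d → (d - c) / 2 ^ n ≤ δ →
      MemLp φ 2 (volume.restrict (Set.Ico c d)) → MassBounds m M c d μ α →
      carlesonSum φ c d α ≠ ∞ →
      (d - c) * G (⨍ t in Set.Ico c d, φ t) (⨍ t in Set.Ico c d, φ t ^ 2)
          ((mass c d μ α root).toReal / (d - c)) ≤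
        (carlesonSum φ c d α).toReal + (∫ t in Set.Ico c d, g t ∂μ) +
          ω * (μ (Set.Ico c d)).toReal + K * (tail n α).toReal +
          M * ∫ t in Set.Ico c d, |φ t ^ 2 - g t| := by
  have hgi : ∀ c d : ℝ, IntegrableOn g (Set.Ico c d) := fun c d =>
    (hg.continuousOn.integrableOn_Icc (a := c) (b := d)).mono_set Set.Ico_subset_Icc_self
  induction n with
  | zero =>
    intro c d α hcd hδ hφ hb hS
    have hdc : 0 < d - c := sub_pos.2 hcd
    have hM : 0 ≤ M := hm.trans hmM
    have hsq : IntegrableOn (fun t => φ t ^ 2) (Set.Ico c d) := hφ.integrable_sq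
    have habs : IntegrableOn (fun t => |φ t ^ 2 - g t|) (Set.Ico c d) :=
      (hsq.sub (hgi c d)).abs
    have hμ := hb.measure_ne_top hcd
    have hα := hb.tsum_ne_top hcd
    have h1 := hG' _ _ ((mass c d μ α root).toReal / (d - c)) (sq_average_le hcd hφ)
      ((le_div_iff₀ hdc).2 (hb.le_toReal_mass hcd hm))
      ((div_le_iff₀ hdc).2 (hb.toReal_mass_le hcd hM))
    have h2 : (d - c) * G (⨍ t in Set.Ico c d, φ t) (⨍ t in Set.Ico c d, φ t ^ 2)
        ((mass c d μ α root).toReal / (d - c)) ≤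
        (⨍ t in Set.Ico c d, φ t ^ 2) * (mass c d μ α root).toReal := by
      calc _ ≤ (d - c) * ((⨍ t in Set.Ico c d, φ t ^ 2) *
            ((mass c d μ α root).toReal / (d - c))) := mul_le_mul_of_nonneg_left h1 hdc.le
        _ = _ := by field_simp
    have hmass : (mass c d μ α root).toReal =
        (μ (Set.Ico c d)).toReal + (tail 0 α).toReal := by
      rw [mass_root hcd.le, tail_zero, ENNReal.toReal_add hμ hα]
    have hsplit : ⨍ t in Set.Ico c d, φ t ^ 2 ≤
        (⨍ t in Set.Ico c d, g t) + (∫ t in Set.Ico c d, |φ t ^ 2 - g t|) / (d - c) := by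
      rw [average_Ico hcd.le, average_Ico hcd.le, ← add_div]
      refine div_le_div_of_nonneg_right ?_ hdc.le
      rw [← integral_add (hgi c d) habs]
      refine integral_mono hsq ((hgi c d).add habs) fun t => ?_
      have := le_abs_self (φ t ^ 2 - g t)
      simp only
      linarith
    have hnn : 0 ≤ ∫ t in Set.Ico c d, |φ t ^ 2 - g t| :=
      integral_nonneg fun t => abs_nonneg _
    have h3 : (∫ t in Set.Ico c d, |φ t ^ 2 - g t|) / (d - c) * (mass c d μ α root).toReal ≤
        M * ∫ t in Set.Ico c d, |φ t ^ 2 - g t| := by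
      calc _ ≤ (∫ t in Set.Ico c d, |φ t ^ 2 - g t|) / (d - c) * (M * (d - c)) :=
            mul_le_mul_of_nonneg_left (hb.toReal_mass_le hcd hM) (by positivity)
        _ = _ := by field_simp
    have havgK : ⨍ t in Set.Ico c d, g t ≤ K := by
      rw [average_Ico hcd.le, div_le_iff₀ hdc]
      calc ∫ t in Set.Ico c d, g t ≤ ∫ t in Set.Ico c d, K :=
            integral_mono (hgi c d) (integrable_const K) hK
        _ = K * (d - c) := by simp [Real.volume_real_Ico_of_le hcd.le, mul_comm]
    have havg : ∀ t ∈ Set.Ico c d, ⨍ s in Set.Ico c d, g s ≤ g t + ω := by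
      intro t ht
      rw [average_Ico hcd.le, div_le_iff₀ hdc]
      calc ∫ s in Set.Ico c d, g s ≤ ∫ s in Set.Ico c d, (g t + ω) := by
            refine setIntegral_mono_on (hgi c d) (integrable_const _) measurableSet_Ico
              fun s hs => ?_
            have : |s - t| ≤ δ := by
              rw [abs_le]
              simp only [pow_zero, div_one] at hδ
              constructor <;> linarith [hs.1, hs.2, ht.1, ht.2]
            linarith [(abs_le.1 (hω s t this)).2]
        _ = (g t + ω) * (d - c) := by
            simp [Real.volume_real_Ico_of_le hcd.le, mul_comm]
    have hfin : IsFiniteMeasure (μ.restrict (Set.Ico c d)) :=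
      ⟨by rw [Measure.restrict_apply_univ]; exact hμ.lt_top⟩
    have hgμ : IntegrableOn g (Set.Ico c d) μ := hb.integrableOn hcd (hgi c d)
    have h4 : (⨍ t in Set.Ico c d, g t) * (μ (Set.Ico c d)).toReal ≤
        (∫ t in Set.Ico c d, g t ∂μ) + ω * (μ (Set.Ico c d)).toReal := by
      calc (⨍ t in Set.Ico c d, g t) * (μ (Set.Ico c d)).toReal
          = ∫ t in Set.Ico c d, (⨍ s in Set.Ico c d, g s) ∂μ := by
            simp [Measure.real, mul_comm]
        _ ≤ ∫ t in Set.Ico c d, (g t + ω) ∂μ :=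
            setIntegral_mono_on (integrable_const _) (hgμ.add (integrable_const ω))
              measurableSet_Ico havg
        _ = _ := by
            rw [integral_add hgμ (integrable_const ω)]
            simp [Measure.real, mul_comm]
    have h5 : (⨍ t in Set.Ico c d, g t) * (tail 0 α).toReal ≤ K * (tail 0 α).toReal :=
      mul_le_mul_of_nonneg_right havgK ENNReal.toReal_nonneg
    have h6 := mul_le_mul_of_nonneg_right hsplit
      (ENNReal.toReal_nonneg (a := mass c d μ α root))
    have h7 : 0 ≤ (carlesonSum φ c d α).toReal := ENNReal.toReal_nonneg
    rw [add_mul] at h6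
    have h8 : (⨍ t in Set.Ico c d, g t) * (mass c d μ α root).toReal =
        (⨍ t in Set.Ico c d, g t) * (μ (Set.Ico c d)).toReal +
          (⨍ t in Set.Ico c d, g t) * (tail 0 α).toReal := by rw [hmass, mul_add]
    linarith
  | succ n ih =>
    intro c d α hcd hδ hφ hb hS
    have hdc : 0 < d - c := sub_pos.2 hcd
    have hM : 0 ≤ M := hm.trans hmM
    have hc : c < (c + d) / 2 := by linarith
    have hd : (c + d) / 2 < d := by linarith
    have hsubl : Set.Ico c ((c + d) / 2) ⊆ Set.Ico c d := Set.Ico_subset_Ico_right hd.le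
    have hsubr : Set.Ico ((c + d) / 2) d ⊆ Set.Ico c d := Set.Ico_subset_Ico_left hc.le
    have el : (c + d) / 2 - c = (d - c) / 2 := by ring
    have er : d - (c + d) / 2 = (d - c) / 2 := by ring
    have hbl := hb.left hcd
    have hbr := hb.right hcd
    have hφl := hφ.mono_measure (Measure.restrict_mono_set volume hsubl)
    have hφr := hφ.mono_measure (Measure.restrict_mono_set volume hsubr)
    have hSeq := carlesonSum_eq φ c d α
    have hSt : carlesonSum φ c ((c + d) / 2) (α ∘ leftHalf) +
        carlesonSum φ ((c + d) / 2) d (α ∘ rightHalf) ≠ ∞ :=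
      ne_top_of_le_ne_top hS (hSeq ▸ le_add_self)
    obtain ⟨hSl, hSr⟩ := ENNReal.add_ne_top.1 hSt
    have hδ' : (d - c) / 2 / 2 ^ n ≤ δ := by
      rw [div_div, ← pow_succ']; exact hδ
    have IHl := ih c ((c + d) / 2) (α ∘ leftHalf) hc (by rw [el]; exact hδ') hφl hbl hSl
    have IHr := ih ((c + d) / 2) d (α ∘ rightHalf) hd (by rw [er]; exact hδ') hφr hbr hSr
    have hsq : IntegrableOn (fun t => φ t ^ 2) (Set.Ico c d) := hφ.integrable_sq
    have hi : IntegrableOn φ (Set.Ico c d) := hφ.integrable one_le_two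
    have habs : IntegrableOn (fun t => |φ t ^ 2 - g t|) (Set.Ico c d) :=
      (hsq.sub (hgi c d)).abs
    have hgμ : IntegrableOn g (Set.Ico c d) μ := hb.integrableOn hcd (hgi c d)
    have hμeq : (μ (Set.Ico c d)).toReal = (μ (Set.Ico c ((c + d) / 2))).toReal +
        (μ (Set.Ico ((c + d) / 2) d)).toReal := by
      rw [measure_Ico_half hcd,
        ENNReal.toReal_add (hbl.measure_ne_top hc) (hbr.measure_ne_top hd)]
    have htail : (tail (n + 1) α).toReal =
        (tail n (α ∘ leftHalf)).toReal + (tail n (α ∘ rightHalf)).toReal := by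
      rw [tail_succ, ENNReal.toReal_add]
      · exact ne_top_of_le_ne_top (hbl.tsum_ne_top hc) (tail_le _ _)
      · exact ne_top_of_le_ne_top (hbr.tsum_ne_top hd) (tail_le _ _)
    have hSR : (carlesonSum φ c d α).toReal = (⨍ t in Set.Ico c d, φ t) ^ 2 * α root +
        ((carlesonSum φ c ((c + d) / 2) (α ∘ leftHalf)).toReal +
          (carlesonSum φ ((c + d) / 2) d (α ∘ rightHalf)).toReal) := by
      rw [hSeq, ENNReal.toReal_add (ENNReal.mul_ne_top ENNReal.ofReal_ne_top ENNReal.coe_ne_top)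
        hSt, ENNReal.toReal_add hSl hSr, ENNReal.toReal_mul,
        ENNReal.toReal_ofReal (sq_nonneg _), ENNReal.coe_toReal]
    have hmass : (mass c d μ α root).toReal = α root +
        ((mass c ((c + d) / 2) μ (α ∘ leftHalf) root).toReal +
          (mass ((c + d) / 2) d μ (α ∘ rightHalf) root).toReal) := by
      rw [mass_root_eq_add hcd, ENNReal.toReal_add ENNReal.coe_ne_top
        (ENNReal.add_ne_top.2 ⟨hbl.mass_root_ne_top, hbr.mass_root_ne_top⟩),
        ENNReal.toReal_add hbl.mass_root_ne_top hbr.mass_root_ne_top, ENNReal.coe_toReal]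
    have hml := hbl.le_toReal_mass hc hm
    have hmr := hbr.le_toReal_mass hd hm
    have hMl := hbl.toReal_mass_le hc hM
    have hMr := hbr.toReal_mass_le hd hM
    have hMc := hb.toReal_mass_le hcd hM
    rw [el] at IHl hml hMl
    rw [er] at IHr hmr hMr
    have hdc2 : 0 < (d - c) / 2 := by linarith
    have hx : (mass c d μ α root).toReal / (d - c) =
        ((mass c ((c + d) / 2) μ (α ∘ leftHalf) root).toReal / ((d - c) / 2) +
          (mass ((c + d) / 2) d μ (α ∘ rightHalf) root).toReal / ((d - c) / 2)) / 2 +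
          α root / (d - c) := by
      rw [hmass]
      field_simp
      ring
    have key := hG (⨍ t in Set.Ico c ((c + d) / 2), φ t) (⨍ t in Set.Ico c ((c + d) / 2), φ t ^ 2)
      ((mass c ((c + d) / 2) μ (α ∘ leftHalf) root).toReal / ((d - c) / 2))
      (⨍ t in Set.Ico ((c + d) / 2) d, φ t) (⨍ t in Set.Ico ((c + d) / 2) d, φ t ^ 2)
      ((mass ((c + d) / 2) d μ (α ∘ rightHalf) root).toReal / ((d - c) / 2))
      -- The jump in `x₃` is the mass of the root coefficient per unit length.
      (α root / (d - c)) ((le_div_iff₀ hdc2).2 hml) ((div_le_iff₀ hdc2).2 hMl)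
      ((le_div_iff₀ hdc2).2 hmr) ((div_le_iff₀ hdc2).2 hMr)
      (div_nonneg (α root).2 hdc.le) (by rw [← hx]; exact (div_le_iff₀ hdc).2 hMc)
    rw [← hx, ← average_half hcd hi, ← average_half hcd hsq] at key
    have key' := mul_le_mul_of_nonneg_left key hdc.le
    have e1 : (d - c) * ((α root : ℝ) / (d - c) * (⨍ t in Set.Ico c d, φ t) ^ 2) =
        (⨍ t in Set.Ico c d, φ t) ^ 2 * α root := by field_simp
    rw [mul_add, e1] at key'
    rw [hSR, htail, hμeq, setIntegral_half hcd hgμ, setIntegral_half hcd habs]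
    linarith

-- Take `g` continuous with compact support and `L¹`-close to `φ²`. The oscillation of `g`
-- contributes `ε μ(I)`, the tail `ε`, and `M ε` arises twice: once on the leaves, once in passing
-- from `∫ g dμ` to `∫ φ² dμ`.
open Filter Topology in
lemma minorant_mul_length_le {c d m M : ℝ} (hcd : c < d) (hm : 0 ≤ m) (hmM : m ≤ M)
    {G : ℝ → ℝ → ℝ → ℝ} (hG : MainInequality m M G)
    (hG' : ∀ x₁ x₂ x₃, x₁ ^ 2 ≤ x₂ → m ≤ x₃ → x₃ ≤ M → G x₁ x₂ x₃ ≤ x₂ * x₃)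
    {φ : ℝ → ℝ} {μ : Measure ℝ} {α : Dyadic → ℝ≥0}
    (hφ : MemLp φ 2 (volume.restrict (Set.Ico c d))) (hb : MassBounds m M c d μ α)
    (hS : carlesonSum φ c d α ≠ ∞) :
    (d - c) * G (⨍ t in Set.Ico c d, φ t) (⨍ t in Set.Ico c d, φ t ^ 2)
        ((mass c d μ α root).toReal / (d - c)) ≤
      (carlesonSum φ c d α).toReal + ∫ t in Set.Ico c d, φ t ^ 2 ∂μ := by
  have hM : 0 ≤ M := hm.trans hmM
  have hsq : IntegrableOn (fun t => φ t ^ 2) (Set.Ico c d) := hφ.integrable_sq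
  have key : ∀ ε : ℝ, 0 < ε →
      (d - c) * G (⨍ t in Set.Ico c d, φ t) (⨍ t in Set.Ico c d, φ t ^ 2)
        ((mass c d μ α root).toReal / (d - c)) ≤
      (carlesonSum φ c d α).toReal + (∫ t in Set.Ico c d, φ t ^ 2 ∂μ) +
        ε * ((μ (Set.Ico c d)).toReal + 1 + 2 * M) := by
    intro ε hε
    obtain ⟨g, hgc, hgε, hg, hgi⟩ :=
      Integrable.exists_hasCompactSupport_integral_sub_le hsq hε
    simp only [Real.norm_eq_abs] at hgε
    obtain ⟨K, hK⟩ := hgc.exists_bound_of_continuous hg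
    obtain ⟨δ, hδ, hω⟩ :=
      Metric.uniformContinuous_iff.1 (hgc.uniformContinuous_of_continuous hg) ε hε
    have hlim : Tendsto (fun n : ℕ => (d - c) / 2 ^ n) atTop (𝓝 0) :=
      tendsto_const_nhds.div_atTop (tendsto_pow_atTop_atTop_of_one_lt one_lt_two)
    have htail : Tendsto (fun n => K * (tail n α).toReal) atTop (𝓝 0) := by
      have := (ENNReal.tendsto_toReal ENNReal.zero_ne_top).comp
        (tendsto_tail (hb.tsum_ne_top hcd))
      simpa using this.const_mul K
    obtain ⟨n, hn, hn'⟩ := ((hlim.eventually_lt_const (half_pos hδ)).and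
      (htail.eventually_lt_const hε)).exists
    have h1 := minorant_le_of_uniform hm hmM hG hG' (φ := φ) (μ := μ) (ω := ε) (K := K)
      (δ := δ / 2) hg (fun t => (le_abs_self _).trans (hK t)) (fun s t hst => by
        have := hω (a := s) (b := t) (by rw [Real.dist_eq]; linarith)
        rw [Real.dist_eq] at this
        exact this.le) n c d α hcd hn.le hφ hb hS
    have habs : IntegrableOn (fun t => |φ t ^ 2 - g t|) (Set.Ico c d) := (hsq.sub hgi).abs
    have h2 : ∫ t in Set.Ico c d, |φ t ^ 2 - g t| ∂μ ≤ M * ε := by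
      calc ∫ t in Set.Ico c d, |φ t ^ 2 - g t| ∂μ
          ≤ ∫ t, |φ t ^ 2 - g t| ∂(ENNReal.ofReal M • volume.restrict (Set.Ico c d)) :=
            integral_mono_measure (hb.restrict_le hcd) (ae_of_all _ fun t => abs_nonneg _)
              (habs.smul_measure ENNReal.ofReal_ne_top)
        _ = M * ∫ t in Set.Ico c d, |φ t ^ 2 - g t| := by
            rw [integral_smul_measure, ENNReal.toReal_ofReal hM, smul_eq_mul]
        _ ≤ M * ε := mul_le_mul_of_nonneg_left hgε hM
    have h3 : ∫ t in Set.Ico c d, g t ∂μ ≤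
        (∫ t in Set.Ico c d, φ t ^ 2 ∂μ) + ∫ t in Set.Ico c d, |φ t ^ 2 - g t| ∂μ := by
      rw [← integral_add (hb.integrableOn hcd hsq) (hb.integrableOn hcd habs)]
      refine integral_mono (hb.integrableOn hcd hgi)
        ((hb.integrableOn hcd hsq).add (hb.integrableOn hcd habs)) fun t => ?_
      have := neg_abs_le (φ t ^ 2 - g t)
      simp only
      linarith
    have h4 := mul_le_mul_of_nonneg_left hgε hM
    linarith
  refine le_of_forall_pos_le_add fun η hη => ?_
  have hC : 0 < (μ (Set.Ico c d)).toReal + 1 + 2 * M := by positivity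
  have := key (η / ((μ (Set.Ico c d)).toReal + 1 + 2 * M)) (by positivity)
  rwa [div_mul_cancel₀ _ hC.ne'] at this

lemma Admissible.massBounds {c d m M x₁ x₂ x₃ : ℝ} {φ : ℝ → ℝ} {μ : Measure ℝ}
    {α : Dyadic → ℝ≥0} (h : Admissible c d m M x₁ x₂ x₃ φ μ α) : MassBounds m M c d μ α :=
  fun J => ⟨h.le_mass J, h.mass_le J⟩

lemma ofReal_minorant_le_Bmin {c d m M : ℝ} (hcd : c < d) (hm : 0 ≤ m) {G : ℝ → ℝ → ℝ → ℝ}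
    (hG : MainInequality m M G)
    (hG' : ∀ x₁ x₂ x₃, x₁ ^ 2 ≤ x₂ → m ≤ x₃ → x₃ ≤ M → G x₁ x₂ x₃ ≤ x₂ * x₃)
    {x₁ x₂ x₃ : ℝ} (hm3 : m ≤ x₃) (h3M : x₃ ≤ M) :
    ENNReal.ofReal (G x₁ x₂ x₃) ≤ Bmin c d m M x₁ x₂ x₃ := by
  refine le_iInf fun φ => le_iInf fun μ => le_iInf fun α => le_iInf fun h => ?_
  have hdc : 0 < d - c := sub_pos.2 hcd
  have hb := h.massBounds
  have hvol : volume (Set.Ico c d) = ENNReal.ofReal (d - c) := Real.volume_Ico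
  have hvol0 : volume (Set.Ico c d) ≠ 0 := by simp [hcd]
  have hx3 : (mass c d μ α root).toReal / (d - c) = x₃ := by
    have := h.mass_eq
    rw [← mass_root hcd.le, hvol] at this
    rw [← ENNReal.toReal_ofReal (hm.trans hm3), ← this, ENNReal.toReal_div,
      ENNReal.toReal_ofReal hdc.le]
  rw [functional, ENNReal.le_div_iff_mul_le (Or.inl hvol0) (Or.inl (by simp))]
  by_cases hS : carlesonSum φ c d α = ∞
  · rw [← carlesonSum, hS, add_top]
    exact le_top
  · have key := minorant_mul_length_le hcd hm (hm3.trans h3M) hG hG' h.memLp hb hS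
    rw [h.avg_eq, h.avg_sq_eq, hx3] at key
    rw [hvol, ← ENNReal.ofReal_mul' hdc.le, ← carlesonSum, ← ENNReal.ofReal_toReal hS,
      ← ofReal_integral_eq_lintegral_ofReal (hb.integrableOn hcd h.memLp.integrable_sq)
        (ae_of_all _ fun t => sq_nonneg _), ← ENNReal.ofReal_add
        (integral_nonneg fun t => sq_nonneg _) ENNReal.toReal_nonneg]
    exact ENNReal.ofReal_le_ofReal (by linarith)

/-! ### Finite configurations and their realization by competitors -/

/-- Points `(x₁, x₂, x₃)` and values of the functional that are attained by finitely many
steps of halving the interval, starting from constant functions and densities. -/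
inductive Reach (m M : ℝ) : ℝ → ℝ → ℝ → ℝ → Prop
  | const (v y : ℝ) (hm : m ≤ y) (hM : y ≤ M) : Reach m M v (v ^ 2) y (v ^ 2 * y)
  | join {p₁ p₂ p₃ v q₁ q₂ q₃ w a : ℝ} (hp : Reach m M p₁ p₂ p₃ v) (hq : Reach m M q₁ q₂ q₃ w)
      (ha : 0 ≤ a) (hM : (p₃ + q₃) / 2 + a ≤ M) :
      Reach m M ((p₁ + q₁) / 2) ((p₂ + q₂) / 2) ((p₃ + q₃) / 2 + a)
        ((v + w) / 2 + a * ((p₁ + q₁) / 2) ^ 2)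

lemma Reach.bounds {m M x₁ x₂ x₃ v : ℝ} (h : Reach m M x₁ x₂ x₃ v) (hm : 0 ≤ m) :
    m ≤ x₃ ∧ x₃ ≤ M ∧ 0 ≤ v := by
  induction h with
  | const v y h1 h2 => exact ⟨h1, h2, mul_nonneg (sq_nonneg _) (hm.trans h1)⟩
  | join hp hq ha hM ihp ihq =>
    exact ⟨by linarith, hM, add_nonneg (by linarith) (mul_nonneg ha (sq_nonneg _))⟩

/-- The family on `[c, d)` with value `a` at the top and given families on the halves. -/
def glue (a : ℝ≥0) (α β : Dyadic → ℝ≥0) : Dyadic → ℝ≥0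
  | ⟨0, _⟩ => a
  | ⟨n + 1, k⟩ =>
    if h : (k : ℕ) < 2 ^ n then α ⟨n, ⟨k, h⟩⟩
    else β ⟨n, ⟨k - 2 ^ n, by have := k.2; have := pow_succ 2 n; omega⟩⟩

lemma glue_root (a : ℝ≥0) (α β : Dyadic → ℝ≥0) : glue a α β root = a := rfl

lemma glue_comp_leftHalf (a : ℝ≥0) (α β : Dyadic → ℝ≥0) : glue a α β ∘ leftHalf = α := by
  ext J
  simp [glue, leftHalf]

lemma glue_comp_rightHalf (a : ℝ≥0) (α β : Dyadic → ℝ≥0) : glue a α β ∘ rightHalf = β := by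
  ext J
  simp [glue, rightHalf]

/-- Admissibility at `(x₁, x₂, x₃)` together with the value `v` of the functional. -/
structure Realizes (m M x₁ x₂ x₃ v c d : ℝ) (φ : ℝ → ℝ) (μ : Measure ℝ)
    (α : Dyadic → ℝ≥0) : Prop where
  memLp : MemLp φ 2 (volume.restrict (Set.Ico c d))
  noAtoms : ∀ t : ℝ, μ {t} = 0
  avg_eq : ⨍ t in Set.Ico c d, φ t = x₁
  avg_sq_eq : ⨍ t in Set.Ico c d, φ t ^ 2 = x₂
  mass_eq : mass c d μ α root = ENNReal.ofReal (x₃ * (d - c))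
  bounds : MassBounds m M c d μ α
  value : ∫⁻ t in Set.Ico c d, ENNReal.ofReal (φ t ^ 2) ∂μ + carlesonSum φ c d α =
    ENNReal.ofReal (v * (d - c))

lemma average_const_Ico {c d : ℝ} (hcd : c < d) (v : ℝ) : ⨍ _ in Set.Ico c d, v = v := by
  have : d - c ≠ 0 := (sub_pos.2 hcd).ne'
  rw [average_Ico hcd.le]
  simp [Real.volume_real_Ico_of_le hcd.le, this]

lemma realizes_const {m M v y c d : ℝ} (hm : 0 ≤ m) (hmy : m ≤ y) (hyM : y ≤ M) (hcd : c < d) :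
    Realizes m M v (v ^ 2) y (v ^ 2 * y) c d (fun _ => v) (ENNReal.ofReal y • volume) 0 where
  memLp := memLp_const v
  noAtoms t := by simp
  avg_eq := average_const_Ico hcd v
  avg_sq_eq := average_const_Ico hcd (v ^ 2)
  mass_eq := by
    rw [mass_root hcd.le, ENNReal.ofReal_mul (hm.trans hmy)]
    simp
  bounds J := by
    have : mass c d (ENNReal.ofReal y • volume) 0 J =
        ENNReal.ofReal y * volume (interval c d J) := by simp [mass]
    rw [this]
    exact ⟨by gcongr, by gcongr⟩
  value := by
    have h := sub_pos.2 hcd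
    have hy := hm.trans hmy
    rw [ENNReal.ofReal_mul (by positivity), ENNReal.ofReal_mul (by positivity)]
    simp [carlesonSum, mul_assoc]

lemma carlesonSum_congr {c d : ℝ} (hcd : c ≤ d) {φ ψ : ℝ → ℝ} (α : Dyadic → ℝ≥0)
    (h : Set.EqOn φ ψ (Set.Ico c d)) : carlesonSum φ c d α = carlesonSum ψ c d α := by
  refine tsum_congr fun J => ?_
  have : avg c d φ J = avg c d ψ J :=
    setAverage_congr_fun (measurableSet_interval c d J)
      (ae_of_all _ fun t ht => h (interval_subset hcd J ht))
  rw [this]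

lemma mass_congr {c d : ℝ} (hcd : c ≤ d) {μ ν : Measure ℝ} (α : Dyadic → ℝ≥0)
    (h : μ.restrict (Set.Ico c d) = ν.restrict (Set.Ico c d)) (J : Dyadic) :
    mass c d μ α J = mass c d ν α J := by
  rw [mass, mass, ← Measure.restrict_eq_self μ (interval_subset hcd J), h,
    Measure.restrict_eq_self ν (interval_subset hcd J)]

/-- The competitor glued from two halves agrees with each piece only on its own half; this transfers
the data. -/
lemma Realizes.congr {m M x₁ x₂ x₃ v c d : ℝ} (hcd : c ≤ d) {φ ψ : ℝ → ℝ} {μ ν : Measure ℝ}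
    {α : Dyadic → ℝ≥0} (h : Realizes m M x₁ x₂ x₃ v c d φ μ α) (hν : ∀ t : ℝ, ν {t} = 0)
    (hφ : Set.EqOn ψ φ (Set.Ico c d))
    (hμ : ν.restrict (Set.Ico c d) = μ.restrict (Set.Ico c d)) :
    Realizes m M x₁ x₂ x₃ v c d ψ ν α where
  memLp := h.memLp.ae_eq ((ae_restrict_iff' measurableSet_Ico).2 (ae_of_all _ fun _ ht => (hφ ht).symm))
  noAtoms := hν
  avg_eq := by
    rw [← h.avg_eq]
    exact setAverage_congr_fun measurableSet_Ico (ae_of_all _ hφ)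
  avg_sq_eq := by
    rw [← h.avg_sq_eq]
    exact setAverage_congr_fun measurableSet_Ico (ae_of_all _ fun t ht => by rw [hφ ht])
  mass_eq := by rw [mass_congr hcd α hμ, h.mass_eq]
  bounds J := by rw [mass_congr hcd α hμ]; exact h.bounds J
  value := by
    rw [← h.value, hμ, carlesonSum_congr hcd α hφ]
    congr 1
    exact setLIntegral_congr_fun measurableSet_Ico fun t ht => by simp only [hφ ht]

/-- The number `a` is mass per unit length, hence the root coefficient `a (d - c)`. -/
lemma realizes_of_half {m M p₁ p₂ p₃ v q₁ q₂ q₃ w c d : ℝ} {a : ℝ≥0} (hm : 0 ≤ m)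
    (hcd : c < d) {φ : ℝ → ℝ} {μ : Measure ℝ} {α β : Dyadic → ℝ≥0}
    (hp3 : m ≤ p₃) (hv : 0 ≤ v) (hq3 : m ≤ q₃) (hw : 0 ≤ w) (hM : (p₃ + q₃) / 2 + a ≤ M)
    (hl : Realizes m M p₁ p₂ p₃ v c ((c + d) / 2) φ μ α)
    (hr : Realizes m M q₁ q₂ q₃ w ((c + d) / 2) d φ μ β) :
    Realizes m M ((p₁ + q₁) / 2) ((p₂ + q₂) / 2) ((p₃ + q₃) / 2 + a)
      ((v + w) / 2 + a * ((p₁ + q₁) / 2) ^ 2) c d φ μ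
      (glue (a * (d - c).toNNReal) α β) := by
  have hdc : 0 < d - c := sub_pos.2 hcd
  have hc : c < (c + d) / 2 := by linarith
  have hd : (c + d) / 2 < d := by linarith
  have el : (c + d) / 2 - c = (d - c) / 2 := by ring
  have er : d - (c + d) / 2 = (d - c) / 2 := by ring
  have hφ : MemLp φ 2 (volume.restrict (Set.Ico c d)) := by
    have h1 : Set.Iio ((c + d) / 2) ∩ Set.Ico c d = Set.Ico c ((c + d) / 2) := by
      ext t
      simp only [Set.mem_inter_iff, Set.mem_Iio, Set.mem_Ico]
      constructor
      · rintro ⟨h1, h2, h3⟩; exact ⟨h2, h1⟩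
      · rintro ⟨h1, h2⟩; exact ⟨h2, h1, by linarith⟩
    have h2 : (Set.Iio ((c + d) / 2))ᶜ ∩ Set.Ico c d = Set.Ico ((c + d) / 2) d := by
      ext t
      simp only [Set.mem_inter_iff, Set.compl_Iio, Set.mem_Ici, Set.mem_Ico]
      constructor
      · rintro ⟨h1, h2, h3⟩; exact ⟨h1, h3⟩
      · rintro ⟨h1, h2⟩; exact ⟨h1, by linarith, h2⟩
    classical
    have := MemLp.piecewise (μ := volume.restrict (Set.Ico c d)) (f := φ) (g := φ) (p := 2)
      (measurableSet_Iio (a := (c + d) / 2))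
      (by rw [Measure.restrict_restrict measurableSet_Iio, h1]; exact hl.memLp)
      (by rw [Measure.restrict_restrict measurableSet_Iio.compl, h2]; exact hr.memLp)
    simpa using this
  have hi : IntegrableOn φ (Set.Ico c d) := hφ.integrable one_le_two
  have havg : ⨍ t in Set.Ico c d, φ t = (p₁ + q₁) / 2 := by
    rw [average_half hcd hi, hl.avg_eq, hr.avg_eq]
  have ha : ((a * (d - c).toNNReal : ℝ≥0) : ℝ≥0∞) = ENNReal.ofReal (a * (d - c)) := by
    rw [ENNReal.ofReal_mul a.coe_nonneg]
    simp [ENNReal.ofReal]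
  have hmass : mass c d μ (glue (a * (d - c).toNNReal) α β) root =
      ENNReal.ofReal (((p₃ + q₃) / 2 + a) * (d - c)) := by
    rw [mass_root_eq_add hcd, glue_root, glue_comp_leftHalf, glue_comp_rightHalf, hl.mass_eq,
      hr.mass_eq, ha, el, er, ← ENNReal.ofReal_add, ← ENNReal.ofReal_add]
    · congr 1; ring
    · exact mul_nonneg a.coe_nonneg hdc.le
    · have := hm.trans hp3
      have := hm.trans hq3
      positivity
    · exact mul_nonneg (hm.trans hp3) (by linarith)
    · exact mul_nonneg (hm.trans hq3) (by linarith)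
  refine ⟨hφ, hl.noAtoms, havg, ?_, hmass, ?_, ?_⟩
  · rw [average_half hcd hφ.integrable_sq, hl.avg_sq_eq, hr.avg_sq_eq]
  · intro J
    rcases eq_root_or_half J with rfl | ⟨K, rfl⟩ | ⟨K, rfl⟩
    · have ha0 : (0 : ℝ) ≤ a := a.coe_nonneg
      rw [hmass, interval_root, Real.volume_Ico, ← ENNReal.ofReal_mul hm,
        ← ENNReal.ofReal_mul (by linarith)]
      constructor
      · exact ENNReal.ofReal_le_ofReal (mul_le_mul_of_nonneg_right (by linarith) hdc.le)
      · exact ENNReal.ofReal_le_ofReal (mul_le_mul_of_nonneg_right hM hdc.le)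
    · rw [mass_leftHalf hcd, interval_leftHalf, glue_comp_leftHalf]
      exact hl.bounds K
    · rw [mass_rightHalf hcd, interval_rightHalf, glue_comp_rightHalf]
      exact hr.bounds K
  · rw [carlesonSum_eq, glue_root, glue_comp_leftHalf, glue_comp_rightHalf, havg, ha,
      ← Ico_union_half hcd, lintegral_union measurableSet_Ico (disjoint_half c d),
      ← ENNReal.ofReal_mul (sq_nonneg _)]
    have h1 := hl.value
    have h2 := hr.value
    rw [el] at h1
    rw [er] at h2
    have h3 : ∀ A B C D E : ℝ≥0∞, A + B + (C + (D + E)) = C + ((A + D) + (B + E)) := by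
      intros; ring
    rw [h3, h1, h2, ← ENNReal.ofReal_add (by positivity) (by positivity),
      ← ENNReal.ofReal_add (mul_nonneg (sq_nonneg _) (mul_nonneg a.coe_nonneg hdc.le)) (by positivity)]
    congr 1
    ring

lemma Reach.exists_realizes {m M x₁ x₂ x₃ v : ℝ} (hm : 0 ≤ m) (h : Reach m M x₁ x₂ x₃ v) :
    ∀ c d : ℝ, c < d → ∃ φ μ α, Realizes m M x₁ x₂ x₃ v c d φ μ α := by
  induction h with
  | const v y hmy hyM => exact fun c d hcd => ⟨_, _, _, realizes_const hm hmy hyM hcd⟩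
  | @join p₁ p₂ p₃ v q₁ q₂ q₃ w a hp hq ha hM ihp ihq =>
    intro c d hcd
    have hc : c < (c + d) / 2 := by linarith
    have hd : (c + d) / 2 < d := by linarith
    obtain ⟨φ, μ, α, hl⟩ := ihp c ((c + d) / 2) hc
    obtain ⟨ψ, ν, β, hr⟩ := ihq ((c + d) / 2) d hd
    obtain ⟨hp1, -, hp2⟩ := hp.bounds hm
    obtain ⟨hq1, -, hq2⟩ := hq.bounds hm
    lift a to ℝ≥0 using ha
    classical
    let ρ := μ.restrict (Set.Ico c ((c + d) / 2)) + ν.restrict (Set.Ico ((c + d) / 2) d)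
    have hρ : ∀ t : ℝ, ρ {t} = 0 := by
      intro t
      have h1 : μ.restrict (Set.Ico c ((c + d) / 2)) {t} = 0 :=
        le_antisymm ((Measure.restrict_le_self _).trans (hl.noAtoms t).le) zero_le
      have h2 : ν.restrict (Set.Ico ((c + d) / 2) d) {t} = 0 :=
        le_antisymm ((Measure.restrict_le_self _).trans (hr.noAtoms t).le) zero_le
      simp only [ρ, Measure.add_apply, h1, h2, add_zero]
    have hdisj := Set.disjoint_iff_inter_eq_empty.1 (disjoint_half c d)
    refine ⟨(Set.Iio ((c + d) / 2)).piecewise φ ψ, ρ, _,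
      realizes_of_half hm hcd hp1 hp2 hq1 hq2 hM
        (hl.congr hc.le hρ ?_ ?_) (hr.congr hd.le hρ ?_ ?_)⟩
    · exact fun t ht => Set.piecewise_eq_of_mem _ _ _ ht.2
    · simp only [ρ, Measure.restrict_add, Measure.restrict_restrict measurableSet_Ico,
        Set.inter_self, hdisj, Measure.restrict_empty, add_zero]
    · exact fun t ht => Set.piecewise_eq_of_notMem _ _ _ (not_lt.2 ht.1)
    · rw [Set.inter_comm] at hdisj
      simp only [ρ, Measure.restrict_add, Measure.restrict_restrict measurableSet_Ico,
        Set.inter_self, hdisj, Measure.restrict_empty, zero_add]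

lemma Reach.Bmin_le {c d m M x₁ x₂ x₃ v : ℝ} (hcd : c < d) (hm : 0 ≤ m)
    (h : Reach m M x₁ x₂ x₃ v) : Bmin c d m M x₁ x₂ x₃ ≤ ENNReal.ofReal v := by
  obtain ⟨φ, μ, α, hr⟩ := h.exists_realizes hm c d hcd
  obtain ⟨h1, -, h2⟩ := h.bounds hm
  have hdc : 0 < d - c := sub_pos.2 hcd
  have hvol : volume (Set.Ico c d) = ENNReal.ofReal (d - c) := Real.volume_Ico
  have e : ∀ y : ℝ, ENNReal.ofReal (y * (d - c)) / ENNReal.ofReal (d - c) =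
      ENNReal.ofReal y := by
    intro y
    rw [← ENNReal.ofReal_div_of_pos hdc, mul_div_cancel_right₀ _ hdc.ne']
  have hadm : Admissible c d m M x₁ x₂ x₃ φ μ α :=
    { memLp := hr.memLp
      noAtoms := hr.noAtoms
      avg_eq := hr.avg_eq
      avg_sq_eq := hr.avg_sq_eq
      mass_eq := by rw [← mass_root hcd.le, hr.mass_eq, hvol, e]
      le_mass := fun J => (hr.bounds J).1
      mass_le := fun J => (hr.bounds J).2 }
  have hval : functional c d φ μ α = ENNReal.ofReal v := by
    rw [functional, ← carlesonSum, hr.value, hvol, e]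
  rw [Bmin, ← hval]
  exact (iInf_le _ φ).trans ((iInf_le _ μ).trans ((iInf_le _ α).trans (iInf_le _ hadm)))

/-! ### Convexity, homogeneity and jumps of the infimum over configurations -/

/-- Midpoint convexity against the nearer endpoint reduces `t` to `2t` or `2t - 1` and halves the
excess over the chord; since `f` is bounded above, iteration drives the excess to zero without any
continuity. -/
lemma le_chord_of_midpoint {f : ℝ → ℝ} {C : ℝ} (hC : ∀ t, 0 ≤ t → t ≤ 1 → f t ≤ C)
    (hf : ∀ s t, 0 ≤ s → s ≤ 1 → 0 ≤ t → t ≤ 1 → f ((s + t) / 2) ≤ (f s + f t) / 2)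
    {θ : ℝ} (h0 : 0 ≤ θ) (h1 : θ ≤ 1) : f θ ≤ (1 - θ) * f 0 + θ * f 1 := by
  have key : ∀ n : ℕ, ∀ t, 0 ≤ t → t ≤ 1 →
      f t ≤ (1 - t) * f 0 + t * f 1 + (|C| + |f 0| + |f 1|) / 2 ^ n := by
    intro n
    induction n with
    | zero =>
      intro t ht ht1
      have h2 := hC t ht ht1
      have h3 := le_abs_self C
      have h4 : -((1 - t) * f 0) ≤ |f 0| := by
        refine (neg_le_abs _).trans ?_
        rw [abs_mul, abs_of_nonneg (by linarith : 0 ≤ 1 - t)]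
        exact mul_le_of_le_one_left (abs_nonneg _) (by linarith)
      have h5 : -(t * f 1) ≤ |f 1| := by
        refine (neg_le_abs _).trans ?_
        rw [abs_mul, abs_of_nonneg ht]
        exact mul_le_of_le_one_left (abs_nonneg _) ht1
      rw [pow_zero, div_one]
      linarith
    | succ n ih =>
      intro t ht ht1
      have e : (|C| + |f 0| + |f 1|) / 2 ^ (n + 1) = (|C| + |f 0| + |f 1|) / 2 ^ n / 2 := by
        rw [pow_succ, div_div]
      rw [e]
      rcases le_total t (1 / 2) with h | h
      · have h2 := hf 0 (2 * t) le_rfl zero_le_one (by linarith) (by linarith)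
        have h3 := ih (2 * t) (by linarith) (by linarith)
        rw [show (0 + 2 * t) / 2 = t by ring] at h2
        linarith
      · have h2 := hf 1 (2 * t - 1) zero_le_one le_rfl (by linarith) (by linarith)
        have h3 := ih (2 * t - 1) (by linarith) (by linarith)
        rw [show (1 + (2 * t - 1)) / 2 = t by ring] at h2
        linarith
  have hlim : Filter.Tendsto
      (fun n : ℕ => (1 - θ) * f 0 + θ * f 1 + (|C| + |f 0| + |f 1|) / 2 ^ n) Filter.atTop
      (nhds ((1 - θ) * f 0 + θ * f 1 + 0)) :=
    tendsto_const_nhds.add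
      (tendsto_const_nhds.div_atTop (tendsto_pow_atTop_atTop_of_one_lt one_lt_two))
  rw [add_zero] at hlim
  exact ge_of_tendsto' hlim fun n => key n θ h0 h1

/-- The infimum of the values of the functional over the configurations of `Reach`. -/
noncomputable def reachInf (m M x₁ x₂ x₃ : ℝ) : ℝ := sInf {v | Reach m M x₁ x₂ x₃ v}

section
variable {m M x₁ x₂ x₃ : ℝ}

/-- Take `φ = x₁ ± √(x₂ - x₁²)` on the two halves, constant density `x₃`, and no jump. -/
lemma reach_mul (h : x₁ ^ 2 ≤ x₂) (hm3 : m ≤ x₃) (h3M : x₃ ≤ M) :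
    Reach m M x₁ x₂ x₃ (x₂ * x₃) := by
  have := Reach.join (Reach.const (x₁ + √(x₂ - x₁ ^ 2)) x₃ hm3 h3M)
    (Reach.const (x₁ - √(x₂ - x₁ ^ 2)) x₃ hm3 h3M) le_rfl (by linarith : (x₃ + x₃) / 2 + 0 ≤ M)
  have hs : √(x₂ - x₁ ^ 2) ^ 2 = x₂ - x₁ ^ 2 := Real.sq_sqrt (by linarith)
  convert this using 1
  · ring
  · linear_combination -hs
  · ring
  · linear_combination (-x₃) * hs

lemma Reach.scale {v : ℝ} (h : Reach m M x₁ x₂ x₃ v) (k : ℝ) :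
    Reach m M (k * x₁) (k ^ 2 * x₂) x₃ (k ^ 2 * v) := by
  induction h with
  | const v y h1 h2 =>
    convert Reach.const (k * v) y h1 h2 using 1 <;> ring
  | join hp hq ha hM ihp ihq =>
    convert Reach.join ihp ihq ha hM using 1 <;> ring

lemma Reach.jump {v a : ℝ} (h : Reach m M x₁ x₂ x₃ v) (ha : 0 ≤ a) (hM : x₃ + a ≤ M) :
    Reach m M x₁ x₂ (x₃ + a) (v + a * x₁ ^ 2) := by
  convert Reach.join h h ha (by linarith) using 1 <;> ring

lemma bddBelow_reach (hm : 0 ≤ m) : BddBelow {v | Reach m M x₁ x₂ x₃ v} :=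
  ⟨0, fun _ hv => (Reach.bounds hv hm).2.2⟩

lemma reachInf_le {v : ℝ} (hm : 0 ≤ m) (h : Reach m M x₁ x₂ x₃ v) :
    reachInf m M x₁ x₂ x₃ ≤ v :=
  csInf_le (bddBelow_reach hm) h

lemma le_reachInf {y : ℝ} (hx : x₁ ^ 2 ≤ x₂) (hm3 : m ≤ x₃) (h3M : x₃ ≤ M)
    (h : ∀ v, Reach m M x₁ x₂ x₃ v → y ≤ v) : y ≤ reachInf m M x₁ x₂ x₃ :=
  le_csInf ⟨_, reach_mul hx hm3 h3M⟩ h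

lemma reachInf_le_mul (hm : 0 ≤ m) (hx : x₁ ^ 2 ≤ x₂) (hm3 : m ≤ x₃) (h3M : x₃ ≤ M) :
    reachInf m M x₁ x₂ x₃ ≤ x₂ * x₃ :=
  reachInf_le hm (reach_mul hx hm3 h3M)

lemma Bmin_le_reachInf {c d : ℝ} (hcd : c < d) (hm : 0 ≤ m) (hx : x₁ ^ 2 ≤ x₂) (hm3 : m ≤ x₃)
    (h3M : x₃ ≤ M) : Bmin c d m M x₁ x₂ x₃ ≤ ENNReal.ofReal (reachInf m M x₁ x₂ x₃) := by
  have htop : Bmin c d m M x₁ x₂ x₃ ≠ ∞ :=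
    ne_top_of_le_ne_top ENNReal.ofReal_ne_top ((reach_mul hx hm3 h3M).Bmin_le hcd hm)
  rw [← ENNReal.ofReal_toReal htop]
  refine ENNReal.ofReal_le_ofReal (le_reachInf hx hm3 h3M fun v hv => ?_)
  exact ENNReal.toReal_le_of_le_ofReal (hv.bounds hm).2.2 (hv.Bmin_le hcd hm)

lemma reachInf_scale (hm : 0 ≤ m) (hx : x₁ ^ 2 ≤ x₂) (hm3 : m ≤ x₃) (h3M : x₃ ≤ M) (k : ℝ) :
    reachInf m M (k * x₁) (k ^ 2 * x₂) x₃ ≤ k ^ 2 * reachInf m M x₁ x₂ x₃ := by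
  rcases eq_or_ne k 0 with rfl | hk
  -- The rescaling is not invertible for `k = 0`, but there the upper bound `x₂ x₃` is already `0`.
  · have := reachInf_le_mul (x₁ := 0 * x₁) (x₂ := 0 ^ 2 * x₂) hm (by simp) hm3 h3M
    simpa using this
  · have hk2 : 0 < k ^ 2 := by positivity
    rw [← div_le_iff₀' hk2]
    refine le_reachInf hx hm3 h3M fun v hv => ?_
    rw [div_le_iff₀' hk2]
    exact reachInf_le hm (hv.scale k)

lemma reachInf_jump {a : ℝ} (hm : 0 ≤ m) (hx : x₁ ^ 2 ≤ x₂) (hm3 : m ≤ x₃) (ha : 0 ≤ a)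
    (hM : x₃ + a ≤ M) :
    reachInf m M x₁ x₂ (x₃ + a) ≤ reachInf m M x₁ x₂ x₃ + a * x₁ ^ 2 := by
  rw [← sub_le_iff_le_add]
  refine le_reachInf hx hm3 (by linarith) fun v hv => ?_
  rw [sub_le_iff_le_add]
  exact reachInf_le hm (hv.jump ha hM)

lemma reachInf_midpoint (hm : 0 ≤ m) {p₁ p₂ p₃ q₁ q₂ q₃ : ℝ} (hp : p₁ ^ 2 ≤ p₂)
    (hp3 : m ≤ p₃) (hp3' : p₃ ≤ M) (hq : q₁ ^ 2 ≤ q₂) (hq3 : m ≤ q₃) (hq3' : q₃ ≤ M) :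
    reachInf m M ((p₁ + q₁) / 2) ((p₂ + q₂) / 2) ((p₃ + q₃) / 2) ≤
      (reachInf m M p₁ p₂ p₃ + reachInf m M q₁ q₂ q₃) / 2 := by
  have h1 : 2 * reachInf m M ((p₁ + q₁) / 2) ((p₂ + q₂) / 2) ((p₃ + q₃) / 2) -
      reachInf m M q₁ q₂ q₃ ≤ reachInf m M p₁ p₂ p₃ := by
    refine le_reachInf hp hp3 hp3' fun v hv => ?_
    rw [sub_le_comm]
    refine le_reachInf hq hq3 hq3' fun w hw => ?_
    have := reachInf_le hm (Reach.join hv hw le_rfl (by linarith))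
    rw [add_zero, zero_mul, add_zero] at this
    linarith
  linarith

lemma sq_le_of_segment {p₁ p₂ q₁ q₂ θ : ℝ} (hp : p₁ ^ 2 ≤ p₂) (hq : q₁ ^ 2 ≤ q₂) (h0 : 0 ≤ θ)
    (h1 : θ ≤ 1) : ((1 - θ) * p₁ + θ * q₁) ^ 2 ≤ (1 - θ) * p₂ + θ * q₂ := by
  have h2 := mul_nonneg (mul_nonneg h0 (sub_nonneg.2 h1)) (sq_nonneg (p₁ - q₁))
  have h3 := mul_le_mul_of_nonneg_left hp (sub_nonneg.2 h1)
  have h4 := mul_le_mul_of_nonneg_left hq h0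
  linarith

lemma reachInf_segment (hm : 0 ≤ m) {p₁ p₂ p₃ q₁ q₂ q₃ θ : ℝ} (hp : p₁ ^ 2 ≤ p₂)
    (hp3 : m ≤ p₃) (hp3' : p₃ ≤ M) (hq : q₁ ^ 2 ≤ q₂) (hq3 : m ≤ q₃) (hq3' : q₃ ≤ M)
    (h0 : 0 ≤ θ) (h1 : θ ≤ 1) :
    reachInf m M ((1 - θ) * p₁ + θ * q₁) ((1 - θ) * p₂ + θ * q₂) ((1 - θ) * p₃ + θ * q₃) ≤
      (1 - θ) * reachInf m M p₁ p₂ p₃ + θ * reachInf m M q₁ q₂ q₃ := by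
  have hM : 0 ≤ M := hm.trans (hp3.trans hp3')
  have hlo : ∀ t : ℝ, 0 ≤ t → t ≤ 1 → m ≤ (1 - t) * p₃ + t * q₃ := fun t h0 h1 => by
    have := mul_le_mul_of_nonneg_left hp3 (sub_nonneg.2 h1)
    have := mul_le_mul_of_nonneg_left hq3 h0
    linarith
  have hhi : ∀ t : ℝ, 0 ≤ t → t ≤ 1 → (1 - t) * p₃ + t * q₃ ≤ M := fun t h0 h1 => by
    have := mul_le_mul_of_nonneg_left hp3' (sub_nonneg.2 h1)
    have := mul_le_mul_of_nonneg_left hq3' h0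
    linarith
  have hp2 : 0 ≤ p₂ := (sq_nonneg _).trans hp
  have hq2 : 0 ≤ q₂ := (sq_nonneg _).trans hq
  have key := le_chord_of_midpoint
    (f := fun t => reachInf m M ((1 - t) * p₁ + t * q₁) ((1 - t) * p₂ + t * q₂)
      ((1 - t) * p₃ + t * q₃)) (C := (p₂ + q₂) * M) (fun t ht ht1 => by
      refine (reachInf_le_mul hm (sq_le_of_segment hp hq ht ht1) (hlo t ht ht1)
        (hhi t ht ht1)).trans ?_
      refine mul_le_mul ?_ (hhi t ht ht1) (hm.trans (hlo t ht ht1)) (by positivity)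
      have := mul_le_mul_of_nonneg_right (by linarith : 1 - t ≤ 1) hp2
      have := mul_le_mul_of_nonneg_right ht1 hq2
      linarith) (fun s t hs hs1 ht ht1 => by
      have := reachInf_midpoint hm (sq_le_of_segment hp hq hs hs1) (hlo s hs hs1)
        (hhi s hs hs1) (sq_le_of_segment hp hq ht ht1) (hlo t ht ht1) (hhi t ht ht1)
      convert this using 2 <;> ring) h0 h1
  simpa using key

end

/-! ### Upper bounds along extremal segments -/

/-- The point `(1, r, M - ε (M - m))` divides the segment from `(k, k² r, M)` to `(1 + p, (1 + p)²,
m)` with weight `ε` at the latter; a jump of `ε (M - m)` returns to `(1, r, M)`. By homogeneity the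
unknown value occurs on both sides, and dividing by `ε` gives the claim. Hypothesis `hp` is the
balance of second coordinates. -/
lemma reachInf_top_step {m M r ε p : ℝ} (hm : 0 ≤ m) (hmM : m ≤ M) (hr : 1 ≤ r) (hε : 0 < ε)
    (hε1 : ε < 1) (hp : (1 + p) ^ 2 = r * (1 + 2 * p) - ε * r / (1 - ε) * p ^ 2) :
    reachInf m M 1 r M * (1 + 2 * p - ε / (1 - ε) * p ^ 2) ≤ M - m + m * (1 + p) ^ 2 := by
  have h1ε : 0 < 1 - ε := by linarith
  have hL : 0 ≤ M - m := by linarith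
  have hone : (1 : ℝ) ^ 2 ≤ r := by simpa using hr
  -- `k` is forced by the balance of first coordinates, `(1 - ε) k + ε (1 + p) = 1`.
  obtain ⟨k, hk⟩ : ∃ k, k = 1 - ε / (1 - ε) * p := ⟨_, rfl⟩
  have hek : (1 - ε) * k = 1 - ε - ε * p := by rw [hk]; field_simp
  have h1 : (1 - ε) * (k * 1) + ε * (1 + p) = 1 := by linear_combination hek
  have hk2 : (1 - ε) * k ^ 2 = 1 - ε - 2 * ε * p + ε * (ε / (1 - ε) * p ^ 2) := by
    rw [hk]; field_simp; ring
  have h2 : (1 - ε) * (k ^ 2 * r) + ε * (1 + p) ^ 2 = r := by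
    have e : ε * r / (1 - ε) * p ^ 2 = r * (ε / (1 - ε) * p ^ 2) := by ring
    rw [e] at hp
    linear_combination r * hk2 + ε * hp
  have h3 : (1 - ε) * M + ε * m = M - ε * (M - m) := by ring
  have hkr : (k * 1) ^ 2 ≤ k ^ 2 * r := by
    rw [mul_one]
    exact le_mul_of_one_le_right (sq_nonneg k) hr
  have hseg := reachInf_segment (m := m) (M := M) hm hkr hmM le_rfl
    (le_refl ((1 + p) ^ 2)) le_rfl hmM hε.le hε1.le
  rw [h1, h2, h3] at hseg
  have hεL : 0 ≤ ε * (M - m) := by positivity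
  have hεL' : ε * (M - m) ≤ M - m := mul_le_of_le_one_left hL hε1.le
  have hjump := reachInf_jump (m := m) (M := M) (x₁ := 1) (x₂ := r) (x₃ := M - ε * (M - m))
    (a := ε * (M - m)) hm hone (by linarith) hεL (by linarith)
  rw [sub_add_cancel] at hjump
  have hsc := mul_le_mul_of_nonneg_left
    (reachInf_scale (m := m) (M := M) (x₁ := 1) (x₂ := r) (x₃ := M) hm hone hmM le_rfl k) h1ε.le
  have hbd := mul_le_mul_of_nonneg_left
    (reachInf_le hm (Reach.const (m := m) (M := M) (1 + p) m le_rfl hmM)) hε.le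
  have hT : (1 - ε) * (k ^ 2 * reachInf m M 1 r M) =
      (1 - ε - 2 * ε * p + ε * (ε / (1 - ε) * p ^ 2)) * reachInf m M 1 r M := by
    rw [← hk2]; ring
  refine le_of_mul_le_mul_left ?_ hε
  linarith

open Filter Topology in
lemma reachInf_top {m M p : ℝ} (hm : 0 ≤ m) (hmM : m ≤ M) (hp : 0 ≤ p) :
    reachInf m M 1 ((1 + p) ^ 2 / (1 + 2 * p)) M * (1 + 2 * p) ≤
      M - m + m * (1 + p) ^ 2 := by
  have hq : 0 < 1 + 2 * p := by positivity
  obtain ⟨r, hr⟩ : ∃ r, r = (1 + p) ^ 2 / (1 + 2 * p) := ⟨_, rfl⟩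
  have hr1 : r - 1 = p ^ 2 / (1 + 2 * p) := by rw [hr]; field_simp; ring
  have hr1' : 0 ≤ r - 1 := by rw [hr1]; positivity
  rw [← hr]
  -- With `η = ε r / (1 - ε)`, the balance condition reads `(1 + η) p² - 2 (r - 1) p - (r - 1) = 0`;
  -- `P ε` is its larger root, which tends to the given `p` as `ε → 0`.
  let P : ℝ → ℝ := fun ε => ((r - 1) + √((r - 1) ^ 2 + (1 + ε * r / (1 - ε)) * (r - 1))) /
    (1 + ε * r / (1 - ε))
  have hP0 : P 0 = p := by
    have e : (r - 1) ^ 2 + (1 + 0 * r / (1 - 0)) * (r - 1) =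
        (p * (1 + p) / (1 + 2 * p)) ^ 2 := by
      rw [hr1]; field_simp; ring
    simp only [P]
    rw [e, Real.sqrt_sq (by positivity), hr1]
    field_simp
    ring
  have hPc : ContinuousAt P 0 := by
    have h1 : ContinuousAt (fun ε : ℝ => ε * r / (1 - ε)) 0 :=
      ContinuousAt.div (by fun_prop) (by fun_prop) (by norm_num)
    refine ContinuousAt.div ?_ (by fun_prop) (by norm_num)
    exact continuousAt_const.add
      (Real.continuous_sqrt.continuousAt.comp (f := fun ε : ℝ =>
        (r - 1) ^ 2 + (1 + ε * r / (1 - ε)) * (r - 1)) (by fun_prop))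
  have hPt : Tendsto P (𝓝[>] 0) (𝓝 p) := by
    rw [← hP0]
    exact hPc.tendsto.mono_left nhdsWithin_le_nhds
  have hεt : Tendsto (fun ε : ℝ => ε / (1 - ε)) (𝓝[>] 0) (𝓝 0) := by
    have h1 : ContinuousAt (fun ε : ℝ => ε / (1 - ε)) 0 :=
      ContinuousAt.div (by fun_prop) (by fun_prop) (by norm_num)
    have h2 := h1.tendsto.mono_left (nhdsWithin_le_nhds (s := Set.Ioi 0))
    simpa using h2
  have hl : Tendsto (fun ε => reachInf m M 1 r M * (1 + 2 * P ε - ε / (1 - ε) * P ε ^ 2))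
      (𝓝[>] 0) (𝓝 (reachInf m M 1 r M * (1 + 2 * p - 0 * p ^ 2))) :=
    ((tendsto_const_nhds.add (hPt.const_mul 2)).sub (hεt.mul (hPt.pow 2))).const_mul _
  have hrt : Tendsto (fun ε => M - m + m * (1 + P ε) ^ 2) (𝓝[>] 0)
      (𝓝 (M - m + m * (1 + p) ^ 2)) :=
    tendsto_const_nhds.add (((tendsto_const_nhds.add hPt).pow 2).const_mul m)
  rw [zero_mul, sub_zero] at hl
  refine le_of_tendsto_of_tendsto hl hrt ?_
  filter_upwards [Ioo_mem_nhdsGT (zero_lt_one (α := ℝ))] with ε hε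
  have h1ε : 0 < 1 - ε := by linarith [hε.2]
  refine reachInf_top_step hm hmM (by linarith) hε.1 hε.2 ?_
  have hη : 0 ≤ ε * r / (1 - ε) := div_nonneg (mul_nonneg hε.1.le (by linarith)) h1ε.le
  simp only [P]
  generalize ε * r / (1 - ε) = η at hη
  have hs := Real.sq_sqrt (by positivity : 0 ≤ (r - 1) ^ 2 + (1 + η) * (r - 1))
  generalize √((r - 1) ^ 2 + (1 + η) * (r - 1)) = S at hs
  have : 1 + η ≠ 0 := by positivity
  field_simp
  linear_combination (1 + η) * hs

/-- The extremal segment joins a point with `x₃ = M` to a point with `x₁ ^ 2 = x₂`, `x₃ = m`. -/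
lemma reachInf_extremal {m M x₁ x₂ x₃ s : ℝ} (hm : 0 ≤ m) (hmM : m < M) (hm3 : m ≤ x₃)
    (h3M : x₃ ≤ M) (hs : 0 ≤ s)
    (hx : x₁ ^ 2 * ((1 + s * (M - m)) ^ 2 * (1 + 2 * s * (M - x₃))) =
      x₂ * ((1 + s * (M - x₃)) ^ 2 * (1 + 2 * s * (M - m)))) :
    reachInf m M x₁ x₂ x₃ ≤
      (x₃ - m) * x₂ / ((1 + s * (M - m)) ^ 2 * (1 + 2 * s * (M - x₃))) + m * x₂ := by
  obtain ⟨L, rfl⟩ : ∃ L, M = m + L := ⟨M - m, by ring⟩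
  obtain ⟨z, rfl⟩ : ∃ z, x₃ = m + L - z := ⟨m + L - x₃, by ring⟩
  have hL : 0 < L := by linarith
  have hz : 0 ≤ z := by linarith
  have e1 : m + L - m = L := by ring
  have e2 : m + L - (m + L - z) = z := by ring
  have e3 : m + L - z - m = L - z := by ring
  rw [e1, e2] at hx
  rw [e1, e2, e3]
  have hz1 : 0 < 1 + s * z := by positivity
  have hz2 : 0 < 1 + 2 * s * z := by positivity
  have hL1 : 0 < 1 + s * L := by positivity
  have hL2 : 0 < 1 + 2 * s * L := by positivity
  -- The endpoints are `(k, k² r, M)` with `r = (1 + sL)² / (1 + 2sL)`, handled by `reachInf_top` at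
  -- `p = sL`, and `(k (1 + sL), k² (1 + sL)², m)`. The third coordinate fixes the weight `z / L` of
  -- the second endpoint, and the first coordinate fixes `k`.
  obtain ⟨k, hk⟩ : ∃ k, k = x₁ / (1 + s * z) := ⟨_, rfl⟩
  have hx1 : x₁ = k * (1 + s * z) := by rw [hk]; field_simp
  have hx2 : x₂ = k ^ 2 * (1 + s * L) ^ 2 * (1 + 2 * s * z) / (1 + 2 * s * L) := by
    rw [eq_div_iff hL2.ne']
    have h : (1 + s * z) ^ 2 ≠ 0 := by positivity
    refine mul_left_cancel₀ h ?_
    rw [hx1] at hx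
    linear_combination -hx
  have hp : 0 ≤ s * L := by positivity
  have htop := reachInf_top (m := m) (M := m + L) hm (by linarith) hp
  have er : 1 + 2 * (s * L) = 1 + 2 * s * L := by ring
  rw [er, e1, ← le_div_iff₀ hL2] at htop
  have hr : (1 : ℝ) ^ 2 ≤ (1 + s * L) ^ 2 / (1 + 2 * s * L) := by
    rw [one_pow, le_div_iff₀ hL2]
    have := sq_nonneg (s * L)
    linarith
  have hsc := reachInf_scale (m := m) (M := m + L) hm hr (by linarith) le_rfl k
  have hkr : (k * 1) ^ 2 ≤ k ^ 2 * ((1 + s * L) ^ 2 / (1 + 2 * s * L)) := by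
    rw [mul_pow]
    exact mul_le_mul_of_nonneg_left hr (sq_nonneg k)
  have hθ1 : z / L ≤ 1 := by rw [div_le_one hL]; linarith
  have hθ0 : 0 ≤ z / L := by positivity
  have hseg := reachInf_segment (m := m) (M := m + L) hm hkr (by linarith) le_rfl
    (le_refl ((k * (1 + s * L)) ^ 2)) le_rfl (by linarith) hθ0 hθ1
  have hbd := mul_le_mul_of_nonneg_left
    (reachInf_le hm (Reach.const (m := m) (M := m + L) (k * (1 + s * L)) m le_rfl
      (by linarith))) hθ0
  have hA := mul_le_mul_of_nonneg_left (hsc.trans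
    (mul_le_mul_of_nonneg_left htop (sq_nonneg k))) (sub_nonneg.2 hθ1)
  have c1 : (1 - z / L) * (k * 1) + z / L * (k * (1 + s * L)) = x₁ := by
    rw [hx1]; field_simp; ring
  have c2 : (1 - z / L) * (k ^ 2 * ((1 + s * L) ^ 2 / (1 + 2 * s * L))) +
      z / L * (k * (1 + s * L)) ^ 2 = x₂ := by
    rw [hx2]; field_simp; ring
  have c3 : (1 - z / L) * (m + L) + z / L * m = m + L - z := by
    field_simp; ring
  rw [c1, c2, c3] at hseg
  refine hseg.trans ((add_le_add hA hbd).trans (le_of_eq ?_))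
  rw [hx2]
  field_simp
  ring

lemma reachInf_zero_le {m M r y : ℝ} (hm : 0 ≤ m) (hr : 0 ≤ r) (hmy : m ≤ y) (hyM : y ≤ M) :
    reachInf m M 0 r y ≤ r * m := by
  have h := Reach.jump (a := y - m) (reach_mul (m := m) (M := M) (x₁ := 0) (x₂ := r) (x₃ := m)
    (by simpa using hr) le_rfl (hmy.trans hyM)) (by linarith) (by linarith)
  rw [add_sub_cancel] at h
  simpa using reachInf_le hm h

lemma reachInf_le_of_flat {m M x₁ x₂ x₃ : ℝ} (hm : 0 ≤ m) (hx : x₁ ^ 2 ≤ x₂) (hm3 : m ≤ x₃)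
    (h3M : x₃ ≤ M) (h : (M - m) * x₁ ^ 2 ≤ (M - x₃) * x₂) :
    reachInf m M x₁ x₂ x₃ ≤ m * x₂ := by
  have hx2 : 0 ≤ x₂ := (sq_nonneg _).trans hx
  rcases hm3.eq_or_lt with rfl | hlt
  · rw [mul_comm]
    exact reachInf_le_mul hm hx le_rfl h3M
  have hL : 0 < M - m := by linarith
  rcases h3M.eq_or_lt with rfl | hlt'
  · have h0 : x₁ = 0 := by
      rw [sub_self, zero_mul] at h
      have := nonpos_of_mul_nonpos_right h hL
      exact pow_eq_zero_iff two_ne_zero |>.1 (le_antisymm this (sq_nonneg _))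
    subst h0
    rw [mul_comm]
    exact reachInf_zero_le hm hx2 hm3 le_rfl
  have hz : 0 < M - x₃ := by linarith
  -- Join `(0, r, M)` to `(x₁/θ, (x₁/θ)², m)`: the third coordinate dictates `θ`, and the flatness
  -- hypothesis says precisely that the required `r` is non-negative.
  obtain ⟨θ, hθ⟩ : ∃ θ, θ = (M - x₃) / (M - m) := ⟨_, rfl⟩
  have hθ0 : 0 < θ := by rw [hθ]; positivity
  have hθ1 : θ < 1 := by rw [hθ, div_lt_one hL]; linarith
  have h1θ : 0 < 1 - θ := by linarith
  have hx' : x₁ ^ 2 / θ ≤ x₂ := by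
    rw [div_le_iff₀ hθ0, hθ, mul_div_assoc', le_div_iff₀ hL]
    linarith
  have hr : 0 ≤ (x₂ - x₁ ^ 2 / θ) / (1 - θ) := div_nonneg (by linarith) h1θ.le
  have hseg := reachInf_segment (m := m) (M := M) (p₁ := 0) hm (by simpa using hr)
    (hm3.trans h3M) le_rfl (le_refl ((x₁ / θ) ^ 2)) le_rfl (hm3.trans h3M) hθ0.le hθ1.le
  have c1 : (1 - θ) * 0 + θ * (x₁ / θ) = x₁ := by field_simp; ring
  have c2 : (1 - θ) * ((x₂ - x₁ ^ 2 / θ) / (1 - θ)) + θ * (x₁ / θ) ^ 2 = x₂ := by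
    field_simp; ring
  have c3 : (1 - θ) * M + θ * m = x₃ := by rw [hθ]; field_simp; ring
  rw [c1, c2, c3] at hseg
  have hA := mul_le_mul_of_nonneg_left
    (reachInf_zero_le (m := m) (M := M) hm hr (hm3.trans h3M) le_rfl) h1θ.le
  have hbd := mul_le_mul_of_nonneg_left
    (reachInf_le hm (Reach.const (m := m) (M := M) (x₁ / θ) m le_rfl (hm3.trans h3M))) hθ0.le
  refine hseg.trans ((add_le_add hA hbd).trans (le_of_eq ?_))
  rw [← mul_assoc, ← mul_assoc, ← add_mul, c2, mul_comm]

/-! ### The explicit minorants -/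

/-- The family of minorants whose supremum is the lower Bellman function. -/
noncomputable def minorant (m M s x₁ x₂ x₃ : ℝ) : ℝ :=
  m * x₂ + (x₁ ^ 2 / (1 + s * (M - x₃)) - x₂ / (1 + s * (M - m))) / s

/-- First, `(p, A) ↦ p² / A` is convex. Second, lowering the denominator `C = (A + B) / 2` by `sa`
raises its reciprocal by `sa / (C (C - sa)) ≤ sa`, as both factors are at least `1`. -/
lemma sq_half_add_div_le {p q A B s a : ℝ} (hA : 1 ≤ A) (hB : 1 ≤ B) (hs : 0 ≤ s) (ha : 0 ≤ a)
    (h : 1 ≤ (A + B) / 2 - s * a) :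
    ((p + q) / 2) ^ 2 / ((A + B) / 2 - s * a) ≤
      (p ^ 2 / A + q ^ 2 / B) / 2 + s * a * ((p + q) / 2) ^ 2 := by
  have hA0 : 0 < A := by linarith
  have hB0 : 0 < B := by linarith
  have hsa : 0 ≤ s * a := mul_nonneg hs ha
  have h1 : ((p + q) / 2) ^ 2 / ((A + B) / 2) ≤ (p ^ 2 / A + q ^ 2 / B) / 2 := by
    have h2 : (p ^ 2 / A + q ^ 2 / B) / 2 - ((p + q) / 2) ^ 2 / ((A + B) / 2) =
        (p * B - q * A) ^ 2 / (2 * A * B * (A + B)) := by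
      field_simp
      ring
    have h3 : 0 ≤ (p * B - q * A) ^ 2 / (2 * A * B * (A + B)) := by positivity
    linarith
  have h2 : ((p + q) / 2) ^ 2 / ((A + B) / 2 - s * a) ≤
      ((p + q) / 2) ^ 2 / ((A + B) / 2) + s * a * ((p + q) / 2) ^ 2 := by
    have hD : 0 < (A + B) / 2 - s * a := by linarith
    have hC : 1 ≤ (A + B) / 2 := by linarith
    generalize (A + B) / 2 = C at hD hC h
    rw [div_le_iff₀ hD]
    have h3 : C * (C - s * a) ≥ 1 := one_le_mul_of_one_le_of_one_le hC h
    have h4 : (((p + q) / 2) ^ 2 / C + s * a * ((p + q) / 2) ^ 2) * (C - s * a) -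
        ((p + q) / 2) ^ 2 = s * a * ((p + q) / 2) ^ 2 * ((C * (C - s * a) - 1) / C) := by
      field_simp
      ring
    have h5 : 0 ≤ (C * (C - s * a) - 1) / C := div_nonneg (by linarith) (by linarith)
    have h6 : 0 ≤ s * a * ((p + q) / 2) ^ 2 * ((C * (C - s * a) - 1) / C) := by positivity
    linarith
  linarith

lemma mainInequality_minorant {m M s : ℝ} (hs : 0 < s) :
    MainInequality m M (minorant m M s) := by
  intro p₁ p₂ p₃ q₁ q₂ q₃ a hp hp' hq hq' ha hM
  have h := sq_half_add_div_le (p := p₁) (q := q₁) (A := 1 + s * (M - p₃))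
    (B := 1 + s * (M - q₃)) (s := s) (a := a)
    (by have := mul_nonneg hs.le (sub_nonneg.2 hp'); linarith)
    (by have := mul_nonneg hs.le (sub_nonneg.2 hq'); linarith) hs.le ha
    (by have := mul_nonneg hs.le (sub_nonneg.2 hM); linarith)
  have e : (1 + s * (M - p₃) + (1 + s * (M - q₃))) / 2 - s * a =
      1 + s * (M - ((p₃ + q₃) / 2 + a)) := by ring
  rw [e] at h
  have h2 := div_le_div_of_nonneg_right h hs.le
  have e2 : ((p₁ ^ 2 / (1 + s * (M - p₃)) + q₁ ^ 2 / (1 + s * (M - q₃))) / 2 +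
      s * a * ((p₁ + q₁) / 2) ^ 2) / s =
      (p₁ ^ 2 / (1 + s * (M - p₃)) / s + q₁ ^ 2 / (1 + s * (M - q₃)) / s) / 2 +
      a * ((p₁ + q₁) / 2) ^ 2 := by
    field_simp
  rw [e2] at h2
  have e3 : (p₂ + q₂) / 2 / (1 + s * (M - m)) / s =
      (p₂ / (1 + s * (M - m)) / s + q₂ / (1 + s * (M - m)) / s) / 2 := by ring
  simp only [minorant, sub_div, e3]
  linarith

lemma minorant_le_mul {m M s x₁ x₂ x₃ : ℝ} (hs : 0 < s) (hx : x₁ ^ 2 ≤ x₂) (hm3 : m ≤ x₃)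
    (h3M : x₃ ≤ M) : minorant m M s x₁ x₂ x₃ ≤ x₂ * x₃ := by
  have hx2 : 0 ≤ x₂ := (sq_nonneg _).trans hx
  have hz : 1 ≤ 1 + s * (M - x₃) := by
    have := mul_nonneg hs.le (sub_nonneg.2 h3M); linarith
  have hL : 1 ≤ 1 + s * (M - m) := by
    have := mul_nonneg hs.le (sub_nonneg.2 (hm3.trans h3M)); linarith
  have h1 : x₁ ^ 2 / (1 + s * (M - x₃)) ≤ x₂ / (1 + s * (M - x₃)) :=
    div_le_div_of_nonneg_right hx (by linarith)
  have h2 : x₂ / (1 + s * (M - x₃)) - x₂ / (1 + s * (M - m)) =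
      s * (x₂ * (x₃ - m)) / ((1 + s * (M - x₃)) * (1 + s * (M - m))) := by
    rw [div_sub_div _ _ (by linarith) (by linarith)]
    congr 1
    ring
  have h3 : s * (x₂ * (x₃ - m)) / ((1 + s * (M - x₃)) * (1 + s * (M - m))) ≤
      s * (x₂ * (x₃ - m)) :=
    div_le_self (mul_nonneg hs.le (mul_nonneg hx2 (by linarith)))
      (one_le_mul_of_one_le_of_one_le hz hL)
  have h4 : (x₁ ^ 2 / (1 + s * (M - x₃)) - x₂ / (1 + s * (M - m))) / s ≤ x₂ * (x₃ - m) := by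
    rw [div_le_iff₀ hs]
    linarith
  rw [minorant]
  linarith

/-- The hypothesis is the vanishing of the `s`-derivative of `minorant` in cleared form; it
eliminates `x₁²`. -/
lemma minorant_eq {m M s x₁ x₂ x₃ : ℝ} (hs : 0 < s) (hm3 : m ≤ x₃) (h3M : x₃ ≤ M)
    (hx : x₁ ^ 2 * ((1 + s * (M - m)) ^ 2 * (1 + 2 * s * (M - x₃))) =
      x₂ * ((1 + s * (M - x₃)) ^ 2 * (1 + 2 * s * (M - m)))) :
    minorant m M s x₁ x₂ x₃ =
      (x₃ - m) * x₂ / ((1 + s * (M - m)) ^ 2 * (1 + 2 * s * (M - x₃))) + m * x₂ := by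
  obtain ⟨z, hz⟩ : ∃ z, z = M - x₃ := ⟨_, rfl⟩
  obtain ⟨L, hL⟩ : ∃ L, L = M - m := ⟨_, rfl⟩
  have e : x₃ - m = L - z := by linarith
  have hz0 : 0 ≤ z := by linarith
  have hL0 : 0 ≤ L := by linarith
  rw [minorant, e]
  rw [← hz, ← hL] at hx ⊢
  rw [← eq_div_iff (by positivity)] at hx
  rw [hx]
  field_simp
  ring

-- On the boundary `x₁² = x₂` the critical parameter is `s = 0`, where `minorant` divides by zero;
-- its limit supplies the bound instead.
open Filter Topology in
lemma tendsto_minorant_diagonal {m M x₁ x₃ : ℝ} (hm3 : m ≤ x₃) (h3M : x₃ ≤ M) :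
    Tendsto (fun s => minorant m M s x₁ (x₁ ^ 2) x₃) (𝓝[>] 0) (𝓝 (x₁ ^ 2 * x₃)) := by
  have h1 : ContinuousAt (fun s : ℝ => m * x₁ ^ 2 +
      x₁ ^ 2 * (x₃ - m) / ((1 + s * (M - x₃)) * (1 + s * (M - m)))) 0 :=
    continuousAt_const.add (ContinuousAt.div (by fun_prop) (by fun_prop) (by norm_num))
  have h2 := h1.tendsto.mono_left (nhdsWithin_le_nhds (s := Set.Ioi 0))
  have e : m * x₁ ^ 2 + x₁ ^ 2 * (x₃ - m) / ((1 + 0 * (M - x₃)) * (1 + 0 * (M - m))) =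
      x₁ ^ 2 * x₃ := by simp; ring
  rw [e] at h2
  refine h2.congr' ?_
  filter_upwards [self_mem_nhdsWithin] with s hs
  have hs : 0 < s := hs
  have hz : 0 < 1 + s * (M - x₃) := by
    have := mul_nonneg hs.le (sub_nonneg.2 h3M); linarith
  have hL : 0 < 1 + s * (M - m) := by
    have := mul_nonneg hs.le (sub_nonneg.2 (hm3.trans h3M)); linarith
  rw [minorant, div_sub_div _ _ hz.ne' hL.ne']
  congr 1
  rw [div_div, div_eq_div_iff (by positivity) (by positivity)]
  ring

/-! ### The cubic equation -/

/-- With `R(s)` the ratio `(1 + sz)² (1 + 2sL) / ((1 + sL)² (1 + 2sz))`, one has `1 - R(s) = s² (L -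
z) (L + z + 2szL) / ((1 + sL)² (1 + 2sz))`. Apart from `L - z > 0` this is the product of `s / (1 +
sL)` and `s (L + z + 2szL) / ((1 + sL) (1 + 2sz))`, each strictly increasing (`h1` and `h2`). -/
lemma ratio_strictAnti {z L s t : ℝ} (hz : 0 ≤ z) (hzL : z < L) (hs : 0 ≤ s) (hst : s < t) :
    (1 + t * z) ^ 2 * (1 + 2 * t * L) * ((1 + s * L) ^ 2 * (1 + 2 * s * z)) <
      (1 + s * z) ^ 2 * (1 + 2 * s * L) * ((1 + t * L) ^ 2 * (1 + 2 * t * z)) := by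
  have hL : 0 < L := by linarith
  have ht : 0 < t := by linarith
  have hts : 0 < t - s := by linarith
  have h1 : s * (1 + t * L) < t * (1 + s * L) := by linarith
  have h2 : s * (1 + t * L) * (L + z + 2 * s * z * L) * (1 + 2 * t * z) <
      t * (1 + s * L) * (L + z + 2 * t * z * L) * (1 + 2 * s * z) := by
    have : 0 < (t - s) * (L + z + 2 * z * L * (t + s) + 2 * s * t * z ^ 2 * L) := by positivity
    linarith
  have h3 := mul_lt_mul'' h1 h2 (by positivity) (by positivity)
  have h4 := mul_pos (sub_pos.2 hzL) (sub_pos.2 h3)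
  linarith

lemma exists_ratio_root {z L x₁ x₂ : ℝ} (hz : 0 ≤ z) (hzL : z < L) (hx : x₁ ^ 2 ≤ x₂)
    (hzx : z * x₂ < L * x₁ ^ 2) :
    ∃ s, 0 ≤ s ∧ x₁ ^ 2 * ((1 + s * L) ^ 2 * (1 + 2 * s * z)) =
      x₂ * ((1 + s * z) ^ 2 * (1 + 2 * s * L)) := by
  have hL : 0 < L := by linarith
  have hx2 : 0 ≤ x₂ := (sq_nonneg _).trans hx
  have hδ : 0 < L * x₁ ^ 2 - z * x₂ := by linarith
  -- Chosen so that `x₁² T L = x₂ (2 + T z)`, which makes `f T ≥ 0` while `f 0 = x₁² - x₂ ≤ 0`.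
  obtain ⟨T, hT⟩ : ∃ T, T = 2 * x₂ / (L * x₁ ^ 2 - z * x₂) := ⟨_, rfl⟩
  have hT0 : 0 ≤ T := by rw [hT]; positivity
  let f : ℝ → ℝ := fun s => x₁ ^ 2 * ((1 + s * L) ^ 2 * (1 + 2 * s * z)) -
      x₂ * ((1 + s * z) ^ 2 * (1 + 2 * s * L))
  have hf : ContinuousOn f (Set.Icc 0 T) := by
    apply Continuous.continuousOn
    simp only [f]
    fun_prop
  have hf0 : f 0 ≤ 0 := by
    simp only [f]
    linarith
  have hfT : 0 ≤ f T := by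
    have hTe : T * (L * x₁ ^ 2 - z * x₂) = 2 * x₂ := by
      rw [hT, div_mul_cancel₀ _ hδ.ne']
    have h1 : x₂ * (2 + T * z) ≤ x₁ ^ 2 * (1 + T * L) := by
      have := sq_nonneg x₁
      linarith
    have h2 : (1 + T * z) ^ 2 * (1 + 2 * T * L) ≤
        (2 + T * z) * ((1 + T * L) * (1 + 2 * T * z)) := by
      have : 0 ≤ T * z := by positivity
      have : 0 ≤ T * L := by positivity
      have : 0 ≤ T * z * (T * L) := by positivity
      nlinarith [mul_nonneg (mul_nonneg hT0 hz) (mul_nonneg hT0 hz)]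
    have h3 := mul_le_mul_of_nonneg_left h2 hx2
    have h4 := mul_le_mul_of_nonneg_right h1
      (by positivity : 0 ≤ (1 + T * L) * (1 + 2 * T * z))
    simp only [f]
    linarith
  obtain ⟨s, hs, hfs⟩ := intermediate_value_Icc hT0 hf ⟨hf0, hfT⟩
  exact ⟨s, hs.1, sub_eq_zero.1 hfs⟩

lemma ratio_root_unique {z L x₁ x₂ s t : ℝ} (hz : 0 ≤ z) (hzL : z < L) (hx2 : 0 < x₂)
    (hs : 0 ≤ s) (ht : 0 ≤ t)
    (hse : x₁ ^ 2 * ((1 + s * L) ^ 2 * (1 + 2 * s * z)) =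
      x₂ * ((1 + s * z) ^ 2 * (1 + 2 * s * L)))
    (hte : x₁ ^ 2 * ((1 + t * L) ^ 2 * (1 + 2 * t * z)) =
      x₂ * ((1 + t * z) ^ 2 * (1 + 2 * t * L))) : s = t := by
  have hL : 0 < L := by linarith
  have key : x₂ * ((1 + s * z) ^ 2 * (1 + 2 * s * L) * ((1 + t * L) ^ 2 * (1 + 2 * t * z))) =
      x₂ * ((1 + t * z) ^ 2 * (1 + 2 * t * L) * ((1 + s * L) ^ 2 * (1 + 2 * s * z))) := by
    linear_combination (-(1 + t * L) ^ 2 * (1 + 2 * t * z)) * hse +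
      ((1 + s * L) ^ 2 * (1 + 2 * s * z)) * hte
  have key' := mul_left_cancel₀ hx2.ne' key
  rcases lt_trichotomy s t with h | h | h
  · exact absurd key' (ratio_strictAnti hz hzL hs h).ne'
  · exact h
  · exact absurd key' (ratio_strictAnti hz hzL ht h).ne

/-- The substitution is `s = -2b`; for `b ≤ 0` the denominators are positive and can be cleared. -/
lemma cubic_iff {m M x₁ x₂ x₃ b : ℝ} (hx2 : 0 < x₂) (hm3 : m ≤ x₃) (h3M : x₃ ≤ M) (hb : b ≤ 0) :
    Cubic m M x₁ x₂ x₃ b ↔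
      x₁ ^ 2 * ((1 + -2 * b * (M - m)) ^ 2 * (1 + 2 * (-2 * b) * (M - x₃))) =
        x₂ * ((1 + -2 * b * (M - x₃)) ^ 2 * (1 + 2 * (-2 * b) * (M - m))) := by
  have h1 := mul_nonneg (neg_nonneg.2 hb) (sub_nonneg.2 h3M)
  have h2 := mul_nonneg (neg_nonneg.2 hb) (sub_nonneg.2 (hm3.trans h3M))
  have e1 : 0 < 1 - 2 * b * (M - m) := by linarith
  have e2 : 0 < 1 - 4 * b * (M - x₃) := by linarith
  rw [Cubic, div_pow, div_mul_div_comm, div_eq_div_iff hx2.ne' (by positivity)]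
  constructor <;> intro h <;> linear_combination h

lemma B_eq (m M x₂ x₃ a : ℝ) : B m M x₂ x₃ a =
    (x₃ - m) * x₂ / ((1 + -2 * a * (M - m)) ^ 2 * (1 + 2 * (-2 * a) * (M - x₃))) + m * x₂ := by
  rw [B]
  congr 3 <;> ring

/-! ### Lower bounds in the two regions and conclusion -/

lemma ofReal_mul_le_Bmin {c d m M x₁ x₂ x₃ : ℝ} (hcd : c < d) (hm : 0 ≤ m) (hm3 : m ≤ x₃)
    (h3M : x₃ ≤ M) : ENNReal.ofReal (m * x₂) ≤ Bmin c d m M x₁ x₂ x₃ := by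
  refine ofReal_minorant_le_Bmin (G := fun _ x₂ _ => m * x₂) hcd hm ?_ ?_ hm3 h3M
  · intro p₁ p₂ p₃ q₁ q₂ q₃ a _ _ _ _ ha _
    have := mul_nonneg ha (sq_nonneg ((p₁ + q₁) / 2))
    linarith
  · intro y₁ y₂ y₃ hy hmy _
    have := mul_le_mul_of_nonneg_left hmy ((sq_nonneg _).trans hy)
    linarith

lemma ofReal_le_Bmin_of_root {c d m M x₁ x₂ x₃ s : ℝ} (hcd : c < d) (hm : 0 ≤ m)
    (hm3 : m ≤ x₃) (h3M : x₃ ≤ M) (hs : 0 ≤ s)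
    (hx : x₁ ^ 2 * ((1 + s * (M - m)) ^ 2 * (1 + 2 * s * (M - x₃))) =
      x₂ * ((1 + s * (M - x₃)) ^ 2 * (1 + 2 * s * (M - m)))) :
    ENNReal.ofReal ((x₃ - m) * x₂ / ((1 + s * (M - m)) ^ 2 * (1 + 2 * s * (M - x₃))) + m * x₂) ≤
      Bmin c d m M x₁ x₂ x₃ := by
  have key : ∀ t : ℝ, 0 < t →
      ENNReal.ofReal (minorant m M t x₁ x₂ x₃) ≤ Bmin c d m M x₁ x₂ x₃ := fun t ht =>
    ofReal_minorant_le_Bmin hcd hm (mainInequality_minorant ht)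
      (fun _ _ _ => minorant_le_mul ht) hm3 h3M
  rcases hs.eq_or_lt with rfl | hs
  · obtain rfl : x₁ ^ 2 = x₂ := by simpa using hx
    have e : (x₃ - m) * x₁ ^ 2 / ((1 + 0 * (M - m)) ^ 2 * (1 + 2 * 0 * (M - x₃))) +
        m * x₁ ^ 2 = x₁ ^ 2 * x₃ := by simp; ring
    rw [e]
    refine le_of_tendsto (ENNReal.tendsto_ofReal (tendsto_minorant_diagonal hm3 h3M)) ?_
    filter_upwards [self_mem_nhdsWithin] with t ht using key t ht
  · rw [← minorant_eq hs hm3 h3M hx]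
    exact key s hs

end CarlesonBellman

theorem mainTheorem3 (c d : ℝ) (hcd : c < d) (m M : ℝ) (hm : 0 ≤ m)
    (x₁ x₂ x₃ : ℝ) (hx : x₁ ^ 2 ≤ x₂) (hm3 : m ≤ x₃) (h3M : x₃ ≤ M) :
    (0 < x₂ → M - (M - m) * (x₁ ^ 2 / x₂) < x₃ →
      ∃ a : ℝ, a ≤ 0 ∧
        (∀ b : ℝ, b ≤ 0 → (CarlesonBellman.Cubic m M x₁ x₂ x₃ b ↔ b = a)) ∧
        (x₁ ^ 2 < x₂ → a < 0) ∧ (x₁ ^ 2 = x₂ → a = 0) ∧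
        CarlesonBellman.Bmin c d m M x₁ x₂ x₃ =
          ENNReal.ofReal (CarlesonBellman.B m M x₂ x₃ a)) ∧
    (0 < x₂ → x₃ ≤ M - (M - m) * (x₁ ^ 2 / x₂) →
      CarlesonBellman.Bmin c d m M x₁ x₂ x₃ = ENNReal.ofReal (m * x₂)) ∧
    (x₂ = 0 → CarlesonBellman.Bmin c d m M x₁ x₂ x₃ = 0) := by
  have hcubic_dom : 0 < x₂ → M - (M - m) * (x₁ ^ 2 / x₂) < x₃ →
      (M - x₃) * x₂ < (M - m) * x₁ ^ 2 := by
    intro hx2 h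
    rw [← mul_div_assoc, sub_lt_comm, lt_div_iff₀ hx2] at h
    exact h
  refine ⟨fun hx2 h => ?_, fun hx2 h => ?_, fun hx2 => ?_⟩
  · have hdom := hcubic_dom hx2 h
    have hz : 0 ≤ M - x₃ := by linarith
    have hL : 0 ≤ M - m := by linarith
    -- Since `x₁² ≤ x₂`, the region of case (i) forces `m < x₃`, hence also `m < M`.
    have hzL : M - x₃ < M - m := by
      refine lt_of_mul_lt_mul_right (hdom.trans_le ?_) hx2.le
      exact mul_le_mul_of_nonneg_left hx hL
    obtain ⟨s, hs, hroot⟩ := CarlesonBellman.exists_ratio_root hz hzL hx hdom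
    have es : -2 * (-s / 2) = s := by ring
    have ha : -s / 2 ≤ 0 := by linarith
    refine ⟨-s / 2, ha, fun b hb => ?_, fun hlt => ?_, fun heq => ?_, ?_⟩
    · rw [CarlesonBellman.cubic_iff hx2 hm3 h3M hb]
      constructor
      · intro hb'
        have := CarlesonBellman.ratio_root_unique hz hzL hx2 (by linarith) hs hb' hroot
        linarith
      · rintro rfl
        rw [es]
        exact hroot
    · rcases hs.eq_or_lt with rfl | hs
      · simp only [zero_mul, mul_zero, add_zero, one_pow, mul_one] at hroot
        exact absurd hroot hlt.ne
      · linarith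
    · have h0 : x₁ ^ 2 * ((1 + 0 * (M - m)) ^ 2 * (1 + 2 * 0 * (M - x₃))) =
          x₂ * ((1 + 0 * (M - x₃)) ^ 2 * (1 + 2 * 0 * (M - m))) := by
        rw [heq]; ring
      have := CarlesonBellman.ratio_root_unique hz hzL hx2 hs le_rfl hroot h0
      rw [this]
      norm_num
    · rw [CarlesonBellman.B_eq, es]
      refine le_antisymm ?_ (CarlesonBellman.ofReal_le_Bmin_of_root hcd hm hm3 h3M hs hroot)
      exact (CarlesonBellman.Bmin_le_reachInf hcd hm hx hm3 h3M).trans (ENNReal.ofReal_le_ofReal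
        (CarlesonBellman.reachInf_extremal hm (by linarith) hm3 h3M hs hroot))
  · have hflat : (M - m) * x₁ ^ 2 ≤ (M - x₃) * x₂ := by
      rw [← mul_div_assoc, le_sub_comm, div_le_iff₀ hx2] at h
      exact h
    refine le_antisymm ?_ (CarlesonBellman.ofReal_mul_le_Bmin hcd hm hm3 h3M)
    exact (CarlesonBellman.Bmin_le_reachInf hcd hm hx hm3 h3M).trans (ENNReal.ofReal_le_ofReal
      (CarlesonBellman.reachInf_le_of_flat hm hx hm3 h3M hflat))
  · have h := (CarlesonBellman.Bmin_le_reachInf hcd hm hx hm3 h3M).trans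
      (ENNReal.ofReal_le_ofReal (CarlesonBellman.reachInf_le_mul hm hx hm3 h3M))
    rw [hx2, zero_mul, ENNReal.ofReal_zero] at h
    rw [hx2]
    exact le_antisymm h zero_le
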